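/- Let $(V,E)$ be a finite directed graph (loops and multiple edges allowed) in which every vertex has at least one outgoing edge; write $i(e)$ and $t(e)$ for the initial and terminal vertices of $e\in E$. Assume that it is strongly connected, i.e. for all $v,v'\in V$ there is a directed path of positive length from $v$ to $v'$. For each $e\in E$ let $\psi_e(\xi)=T_e\xi+t_e$ be a map of $\mathbb R^2$ with $t_e\in\mathbb R^2$ and $$T_e=\begin{pmatrix}\pm a_e&0\\0&\pm b_e\end{pmatrix}\quad\text{or}\quad T_e=\begin{pmatrix}0&\pm a_e\\ \pm b_e&0\end{pmatrix},\qquad 0<a_e,b_e<1$$ (a strongly connected planar box-like self-affine graph-directed IFS). Let $\{X_v\}_{v\in V}$ be the unique family of non-empty compact sets with $X_v=\bigcup_{e:\,i(e)=v}\psi_e(X_{t(e)})$ for all $v\in V$. Let $(p_e)_{e\in E}$ be positive numbers with $\sum_{e:\,i(e)=v}p_e=1$ for all $v\in V$, and let $\{\mu_v\}_{v\in V}$ be the associated family of Borel probability measures, $\mu_v$ supported on $X_v$, with $$\mu_v=\sum_{e:\,i(e)=v}p_e\cdot\mu_{t(e)}\circ\psi_e^{-1}\quad\text{for all }v\in V.$$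 Let $\mu_v^x,\mu_v^y$ be the projections of $\mu_v$ onto the $x$-axis and the $y$-axis. For a compactly supported Borel probability measure $\nu$ on $\mathbb R$, $q\ge 0$ and $\delta>0$ put $\mathcal D^q_\delta(\nu)=\sum_Q\nu(Q)^q$, the sum over the closed intervals $Q=[k\delta,(k+1)\delta]$, $k\in\mathbb Z$, with $\nu(Q)>0$. The $L^q$-spectrum $\tau_\nu(q)$ exists if the lower and upper limits of $\log\mathcal D^q_\delta(\nu)/(-\log\delta)$ as $\delta\to0+$ coincide and are finite, and it is then their common value. Then $\tau_{\mu_v^x}(q)$ and $\tau_{\mu_v^y}(q)$ exist for all $q\ge0$ and $v\in V$. Moreover, the family $\{\mu_v^x,\mu_v^y\}_{v\in V}$ (indexed by $V\times\{x,y\}$, so that members with different indices count as different even if they are equal as measures) can be divided into two disjoint families $A$ and $B$ with $\#A=\#B=\#V$ such that for all $q\ge 0$ there are real numbers $\tau_A(q),\tau_B(q)$ with $$\tau_\nu(q)=\tau_A(q)\ \text{ for all }\nu\in A,\qquad \tau_\nu(q)=\tau_B(q)\ \text{ for all }\nu\in B,$$ and for all $v\in V$ either $\mu_v^x\in A,\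 \mu_v^y\in B$ or $\mu_v^x\in B,\ \mu_v^y\in A$. In particular, when all $T_e$ are diagonal, one can take $A=\{\mu_v^x\}_{v\in V}$ and $B=\{\mu_v^y\}_{v\in V}$. -/

import Mathlib

open MeasureTheory Filter Topology

noncomputable section

namespace BoxLike

/-- A matrix `diag(±a, ±b)` with `0 < a, b < 1`. -/
def IsContractingDiagonal (T : Matrix (Fin 2) (Fin 2) ℝ) : Prop :=
  ∃ a b : ℝ, (0 < |a| ∧ |a| < 1) ∧ (0 < |b| ∧ |b| < 1) ∧ T = !![a, 0; 0, b]

/-- An anti-diagonal matrix with non-zero entries `±a, ±b`, where `0 < a, b < 1`. -/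
def IsContractingAntiDiagonal (T : Matrix (Fin 2) (Fin 2) ℝ) : Prop :=
  ∃ a b : ℝ, (0 < |a| ∧ |a| < 1) ∧ (0 < |b| ∧ |b| < 1) ∧ T = !![0, a; b, 0]

/-- A planar box-like self-affine graph-directed iterated function system with vertex set `V` and
edge set `E` (loops and multiple edges are allowed); the edge `e` from `src e` to `tgt e` carries
the map `ξ ↦ T e ξ + t e` of the plane. -/
structure GIFS (V E : Type*) where
  /-- initial vertex of an edge -/
  src : E → V
  /-- terminal vertex of an edge -/
  tgt : E → V
  /-- linear parts -/
  T : E → Matrix (Fin 2) (Fin 2) ℝ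
  /-- translation parts -/
  t : E → Fin 2 → ℝ
  exists_edge : ∀ v, ∃ e, src e = v
  boxLike : ∀ e, IsContractingDiagonal (T e) ∨ IsContractingAntiDiagonal (T e)

namespace GIFS

variable {V E : Type*}

/-- The map of the plane attached to an edge. -/
def ψ (G : GIFS V E) (e : E) (ξ : Fin 2 → ℝ) : Fin 2 → ℝ :=
  (G.T e).mulVec ξ + G.t e

/-- There is a directed path (of positive length) from every vertex to every vertex. -/
def StronglyConnected (G : GIFS V E) : Prop :=
  ∀ v v' : V, Relation.TransGen (fun u u' => ∃ e, G.src e = u ∧ G.tgt e = u') v v'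

/-- `X` is the graph-directed self-affine set family: the family of non-empty compact sets
with `X v = ⋃ ψ_e (X (t(e)))`, the union over the edges `e` leaving `v`. -/
def IsAttractor (G : GIFS V E) (X : V → Set (Fin 2 → ℝ)) : Prop :=
  ∀ v, (X v).Nonempty ∧ IsCompact (X v) ∧
    X v = ⋃ (e : E) (_ : G.src e = v), G.ψ e '' X (G.tgt e)

variable [DecidableEq V] [Fintype E]

/-- A positive vector whose entries over the edges leaving any given vertex add up to one. -/
def IsPositiveVector (G : GIFS V E) (p : E → ℝ) : Prop :=
  (∀ e, 0 < p e) ∧ ∀ v, ∑ e with G.src e = v, p e = 1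

/-- `μ` is the graph-directed self-affine measure family of the system and the vector `p`:
Borel probability measures supported on the self-affine set family with
`μ v = ∑ p_e μ_{t(e)} ∘ ψ_e⁻¹`, the sum over the edges `e` leaving `v`. -/
structure IsMeasureFamily (G : GIFS V E) (p : E → ℝ) (μ : V → Measure (Fin 2 → ℝ)) : Prop where
  isProbability : ∀ v, IsProbabilityMeasure (μ v)
  supported : ∃ X : V → Set (Fin 2 → ℝ), G.IsAttractor X ∧ ∀ v, μ v (X v)ᶜ = 0
  selfAffine : ∀ v, μ v =
    ∑ e with G.src e = v, ENNReal.ofReal (p e) • (μ (G.tgt e)).map (G.ψ e)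

end GIFS

/-- Projection of a planar measure onto a coordinate axis: `i = 0` is the `x`-axis and `i = 1` is
the `y`-axis. -/
def proj (μ : Measure (Fin 2 → ℝ)) (i : Fin 2) : Measure ℝ :=
  μ.map (fun ξ => ξ i)

open Classical in
/-- The sum of `ν(Q)^q` over the closed intervals `Q` of the `δ`-mesh of the line. Intervals of
measure zero contribute nothing, also for `q = 0`. -/
def meshSum (ν : Measure ℝ) (q δ : ℝ) : ℝ :=
  ∑' k : ℤ, if ν (Set.Icc (k * δ) ((k + 1) * δ)) = 0 then 0
    else (ν.real (Set.Icc (k * δ) ((k + 1) * δ))) ^ q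

/-- The upper `L^q`-spectrum. -/
def upperLq (ν : Measure ℝ) (q : ℝ) : EReal :=
  limsup (fun δ : ℝ => ((Real.log (meshSum ν q δ) / (-Real.log δ) : ℝ) : EReal)) (𝓝[>] 0)

/-- The lower `L^q`-spectrum. -/
def lowerLq (ν : Measure ℝ) (q : ℝ) : EReal :=
  liminf (fun δ : ℝ => ((Real.log (meshSum ν q δ) / (-Real.log δ) : ℝ) : EReal)) (𝓝[>] 0)

/-- The `L^q`-spectrum of `ν` at `q` exists and is the real number `τ`. -/
def HasLqSpectrum (ν : Measure ℝ) (q τ : ℝ) : Prop :=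
  lowerLq ν q = τ ∧ upperLq ν q = τ

/-- `A` and `B` divide the family of all projections of the `μ v` into two families of `#V`
members each, every one with a common `L^q`-spectrum for each `q ≥ 0`, such that the two
projections of each `μ v` lie in different families. The member `(v, i)` stands for
`proj (μ v) i`: families are indexed, since distinct members may be equal as measures. -/
def IsSpectralSplitting {V : Type*} (μ : V → Measure (Fin 2 → ℝ)) (A B : Set (V × Fin 2)) :
    Prop :=
  A ∪ B = Set.univ ∧ Disjoint A B ∧ A.ncard = Nat.card V ∧ B.ncard = Nat.card V ∧
  (∀ q : ℝ, 0 ≤ q → ∃ τA τB : ℝ,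
    (∀ m ∈ A, HasLqSpectrum (proj (μ m.1) m.2) q τA) ∧
    (∀ m ∈ B, HasLqSpectrum (proj (μ m.1) m.2) q τB)) ∧
  ∀ v, ((v, 0) ∈ A ∧ (v, 1) ∈ B) ∨ ((v, 0) ∈ B ∧ (v, 1) ∈ A)

end BoxLike

end

noncomputable section

namespace BoxLike

open scoped ENNReal

/-! Each `ψ e` is diagonal or anti-diagonal, so every coordinate of its value depends on exactly one
coordinate of its argument. The projections of the `μ v`, indexed by `V × Fin 2`, therefore form a
graph-directed self-similar family on the line, over a double cover of the original graph whose
sheets are interchanged by anti-diagonal edges (`isSelfSimilarFamily`).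

No separation condition is available, so existence of the spectrum rests on almost multiplicativity.
With `I(r) = ∫ ν(B(x,r))^q dx` (`ballMoment`), the mesh sum at scale `δ` is comparable to `I(δ)/δ`.
At scale `δ` the measure is a mixture of similar copies of members of the family, by ratios
comparable to `δ`. Jensen's inequality for `x ↦ x^q`, applied to the copies near a given point,
gives `I(δδ') ≤ K I(δ) I(δ')` for `q ≥ 1` and the reverse for `q ≤ 1`
(`exists_ballMoment_mul_le_mul`, `exists_mul_ballMoment_le`). Fekete's lemma along `δ = 2^(-n)` then
gives a growth exponent, and mutually reachable vertices have comparable `I`, hence equal spectra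
(`exists_hasLqSpectrum`).

For the splitting, the swap of the two axes is an automorphism of the cover, which makes
reachability in the cover symmetric (`coverReach_symm`). Either the cover is connected and all
projections share one spectrum, or it has two components, each containing exactly one axis over
every vertex; these are `A` and `B`. -/

/-! ### Powers vanishing at zero, and Jensen's inequality for mixtures -/

open Classical in
/-- The power `x ^ q`, with the convention that `0` is sent to `0` also for `q = 0`. -/
def posPow (q : ℝ) (x : ℝ≥0∞) : ℝ≥0∞ := if x = 0 then 0 else x ^ q

@[simp]
theorem posPow_zero (q : ℝ) : posPow q 0 = 0 := by simp [posPow]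

theorem posPow_of_ne_zero (q : ℝ) {x : ℝ≥0∞} (hx : x ≠ 0) : posPow q x = x ^ q := by
  simp [posPow, hx]

@[simp]
theorem posPow_one (q : ℝ) : posPow q 1 = 1 := by simp [posPow]

theorem posPow_eq_rpow {q : ℝ} (hq : 0 < q) (x : ℝ≥0∞) : posPow q x = x ^ q := by
  unfold posPow
  split_ifs with h
  · simp [h, hq]
  · rfl

theorem posPow_mono {q : ℝ} (hq : 0 ≤ q) : Monotone (posPow q) := by
  intro x y hxy
  by_cases hx : x = 0
  · simp [hx]
  have hy : y ≠ 0 := fun h => hx (le_antisymm (h ▸ hxy) zero_le)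
  rw [posPow_of_ne_zero q hx, posPow_of_ne_zero q hy]
  exact ENNReal.rpow_le_rpow hxy hq

theorem measurable_posPow (q : ℝ) : Measurable (posPow q) := by
  unfold posPow
  exact Measurable.ite (measurableSet_singleton 0) measurable_const (by fun_prop)

theorem posPow_ne_top {q : ℝ} (hq : 0 ≤ q) {x : ℝ≥0∞} (hx : x ≠ ∞) : posPow q x ≠ ∞ := by
  unfold posPow
  split_ifs with h
  · simp
  · exact ENNReal.rpow_ne_top_of_nonneg hq hx

theorem posPow_mul {q : ℝ} (hq : 0 ≤ q) {c : ℝ≥0∞} (hc : c ≠ 0) (x : ℝ≥0∞) :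
    posPow q (c * x) = c ^ q * posPow q x := by
  by_cases hx : x = 0
  · simp [hx]
  rw [posPow_of_ne_zero q hx, posPow_of_ne_zero q (mul_ne_zero hc hx),
    ENNReal.mul_rpow_of_nonneg _ _ hq]

/-- A sum is at most twice its larger term, which serves all `q ≥ 0` at once. -/
theorem posPow_add_le {q : ℝ} (hq : 0 ≤ q) (x y : ℝ≥0∞) :
    posPow q (x + y) ≤ 2 ^ q * (posPow q x + posPow q y) := by
  wlog h : x ≤ y generalizing x y
  · rw [add_comm x, add_comm (posPow q x)]
    exact this y x (le_of_not_ge h)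
  calc posPow q (x + y) ≤ posPow q (2 * y) := posPow_mono hq (by rw [two_mul]; gcongr)
    _ = 2 ^ q * posPow q y := posPow_mul hq (by simp) y
    _ ≤ _ := by gcongr; exact le_add_self

theorem posPow_weighted_sum_le {ι : Type*} (s : Finset ι) {q : ℝ} (hq : 1 ≤ q) (w a : ι → ℝ≥0∞)
    (hw : ∑ i ∈ s, w i = 1) :
    posPow q (∑ i ∈ s, w i * a i) ≤ ∑ i ∈ s, w i * posPow q (a i) := by
  simp only [posPow_eq_rpow (zero_lt_one.trans_le hq)]
  exact ENNReal.rpow_arith_mean_le_arith_mean_rpow s w a hw hq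

/-- For `0 < q` this is the power mean inequality with exponent `1/q`, applied to the `a i ^ q`. For
`q = 0` it relies on zero terms contributing nothing: the left side is then the weight of the
non-zero terms. -/
theorem weighted_sum_posPow_le {ι : Type*} (s : Finset ι) {q : ℝ} (hq : 0 ≤ q) (hq1 : q ≤ 1)
    (w a : ι → ℝ≥0∞) (hw : ∑ i ∈ s, w i = 1) :
    ∑ i ∈ s, w i * posPow q (a i) ≤ posPow q (∑ i ∈ s, w i * a i) := by
  rcases hq.eq_or_lt with rfl | hq0
  · by_cases h : ∑ i ∈ s, w i * a i = 0
    · rw [h, posPow_zero]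
      refine (Finset.sum_eq_zero fun i hi => ?_).le
      rcases mul_eq_zero.1 (Finset.sum_eq_zero_iff.1 h i hi) with h | h <;> simp [h]
    · rw [posPow_of_ne_zero _ h, ENNReal.rpow_zero, ← hw]
      refine Finset.sum_le_sum fun i _ => mul_le_of_le_one_right zero_le ?_
      unfold posPow
      split_ifs <;> simp
  · simp only [posPow_eq_rpow hq0]
    have h := ENNReal.rpow_arith_mean_le_arith_mean_rpow s w (fun i => a i ^ q) hw
      (one_le_inv_iff₀.2 ⟨hq0, hq1⟩)
    simp only [ENNReal.rpow_rpow_inv hq0.ne'] at h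
    calc _ = ((∑ i ∈ s, w i * a i ^ q) ^ q⁻¹) ^ q := (ENNReal.rpow_inv_rpow hq0.ne' _).symm
      _ ≤ _ := ENNReal.rpow_le_rpow h hq

/-- Splitting off the total mass of a weighted sum. -/
theorem posPow_sum_eq {ι : Type*} (s : Finset ι) {q : ℝ} (hq : 0 ≤ q) (p a : ι → ℝ≥0∞)
    (h0 : ∑ i ∈ s, p i ≠ 0) (htop : ∑ i ∈ s, p i ≠ ∞) :
    posPow q (∑ i ∈ s, p i * a i) =
      posPow q (∑ i ∈ s, p i) * posPow q (∑ i ∈ s, p i / (∑ j ∈ s, p j) * a i) := by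
  rw [posPow_of_ne_zero q h0, ← posPow_mul hq h0, Finset.mul_sum]
  congr 1
  refine Finset.sum_congr rfl fun i _ => ?_
  rw [← mul_assoc, ENNReal.mul_div_cancel h0 htop]

theorem sum_div_sum_eq_one {ι : Type*} (s : Finset ι) (p : ι → ℝ≥0∞)
    (h0 : ∑ i ∈ s, p i ≠ 0) (htop : ∑ i ∈ s, p i ≠ ∞) :
    ∑ i ∈ s, p i / (∑ j ∈ s, p j) = 1 := by
  simp only [div_eq_mul_inv]
  rw [← Finset.sum_mul, ENNReal.mul_inv_cancel h0 htop]

/-- Normalising the weights to total mass one makes Jensen's inequality applicable pointwise; the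
total mass comes out as a `q`-th power. -/
theorem lintegral_posPow_sum_le {ι : Type*} (s : Finset ι) {q : ℝ} (hq : 1 ≤ q)
    (p : ι → ℝ≥0∞) (htop : ∑ i ∈ s, p i ≠ ∞) (a : ι → ℝ → ℝ≥0∞) (ha : ∀ i, Measurable (a i))
    (N : ℝ≥0∞) (hN : ∀ i ∈ s, ∫⁻ x, posPow q (a i x) ≤ N) :
    ∫⁻ x, posPow q (∑ i ∈ s, p i * a i x) ≤ posPow q (∑ i ∈ s, p i) * N := by
  have hq0 : 0 ≤ q := zero_le_one.trans hq
  by_cases h0 : ∑ i ∈ s, p i = 0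
  · have : ∀ x, ∑ i ∈ s, p i * a i x = 0 := fun x =>
      Finset.sum_eq_zero fun i hi => by simp [Finset.sum_eq_zero_iff.1 h0 i hi]
    simp [this]
  have hw := sum_div_sum_eq_one s p h0 htop
  have hm : ∀ i, Measurable fun x => posPow q (a i x) := fun i => (measurable_posPow q).comp (ha i)
  calc ∫⁻ x, posPow q (∑ i ∈ s, p i * a i x)
      ≤ ∫⁻ x, posPow q (∑ i ∈ s, p i) * ∑ i ∈ s, p i / (∑ j ∈ s, p j) * posPow q (a i x) := by
        refine lintegral_mono fun x => ?_
        rw [posPow_sum_eq s hq0 p (fun i => a i x) h0 htop]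
        gcongr
        exact posPow_weighted_sum_le s hq _ _ hw
    _ = posPow q (∑ i ∈ s, p i) *
          ∑ i ∈ s, p i / (∑ j ∈ s, p j) * ∫⁻ x, posPow q (a i x) := by
        rw [lintegral_const_mul _
          (Finset.measurable_fun_sum _ fun i _ => (hm i).const_mul _),
          lintegral_finsetSum _ fun i _ => (hm i).const_mul _]
        simp only [lintegral_const_mul _ (hm _)]
    _ ≤ posPow q (∑ i ∈ s, p i) * ∑ i ∈ s, p i / (∑ j ∈ s, p j) * N := by
        gcongr with i hi
        exact hN i hi
    _ = _ := by rw [← Finset.sum_mul, hw, one_mul]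

theorem le_lintegral_posPow_sum {ι : Type*} (s : Finset ι) {q : ℝ} (hq : 0 ≤ q) (hq1 : q ≤ 1)
    (p : ι → ℝ≥0∞) (htop : ∑ i ∈ s, p i ≠ ∞) (a : ι → ℝ → ℝ≥0∞) (ha : ∀ i, Measurable (a i))
    (N : ℝ≥0∞) (hN : ∀ i ∈ s, N ≤ ∫⁻ x, posPow q (a i x)) :
    posPow q (∑ i ∈ s, p i) * N ≤ ∫⁻ x, posPow q (∑ i ∈ s, p i * a i x) := by
  by_cases h0 : ∑ i ∈ s, p i = 0
  · simp [h0]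
  have hw := sum_div_sum_eq_one s p h0 htop
  have hm : ∀ i, Measurable fun x => posPow q (a i x) := fun i => (measurable_posPow q).comp (ha i)
  calc posPow q (∑ i ∈ s, p i) * N
      = posPow q (∑ i ∈ s, p i) * ∑ i ∈ s, p i / (∑ j ∈ s, p j) * N := by
        rw [← Finset.sum_mul, hw, one_mul]
    _ ≤ posPow q (∑ i ∈ s, p i) *
          ∑ i ∈ s, p i / (∑ j ∈ s, p j) * ∫⁻ x, posPow q (a i x) := by
        gcongr with i hi
        exact hN i hi
    _ = ∫⁻ x, posPow q (∑ i ∈ s, p i) * ∑ i ∈ s, p i / (∑ j ∈ s, p j) * posPow q (a i x) := by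
        rw [lintegral_const_mul _
          (Finset.measurable_fun_sum _ fun i _ => (hm i).const_mul _),
          lintegral_finsetSum _ fun i _ => (hm i).const_mul _]
        simp only [lintegral_const_mul _ (hm _)]
    _ ≤ _ := by
        refine lintegral_mono fun x => ?_
        rw [posPow_sum_eq s hq p (fun i => a i x) h0 htop]
        gcongr
        exact weighted_sum_posPow_le s hq hq1 _ _ hw

/-! ### The integrated moment sum -/

/-- The integral of `ν(B(x, r)) ^ q` over the line; it is comparable to `r` times the mesh sum. -/
def ballMoment (ν : Measure ℝ) (q r : ℝ) : ℝ≥0∞ :=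
  ∫⁻ x, posPow q (ν (Metric.closedBall x r))

theorem measurable_measure_closedBall (ν : Measure ℝ) [SFinite ν] (r : ℝ) :
    Measurable fun x => ν (Metric.closedBall x r) := by
  have h : MeasurableSet {z : ℝ × ℝ | dist z.2 z.1 ≤ r} :=
    (isClosed_le (by fun_prop) (by fun_prop)).measurableSet
  exact measurable_measure_prodMk_left (ν := ν) h

theorem measurable_posPow_measure_closedBall (ν : Measure ℝ) [SFinite ν] (q r : ℝ) :
    Measurable fun x => posPow q (ν (Metric.closedBall x r)) :=
  (measurable_posPow q).comp (measurable_measure_closedBall ν r)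

theorem ballMoment_mono (ν : Measure ℝ) {q : ℝ} (hq : 0 ≤ q) : Monotone (ballMoment ν q) :=
  fun _ _ h => lintegral_mono fun _ =>
    posPow_mono hq (measure_mono (Metric.closedBall_subset_closedBall h))

theorem ballMoment_mono_measure {ν κ : Measure ℝ} (h : ν ≤ κ) {q : ℝ} (hq : 0 ≤ q) (r : ℝ) :
    ballMoment ν q r ≤ ballMoment κ q r :=
  lintegral_mono fun _ => posPow_mono hq (h _)

theorem ballMoment_smul (ν : Measure ℝ) [SFinite ν] {q : ℝ} (hq : 0 ≤ q) {c : ℝ≥0∞} (hc : c ≠ 0)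
    (r : ℝ) : ballMoment (c • ν) q r = c ^ q * ballMoment ν q r := by
  unfold ballMoment
  rw [← lintegral_const_mul _ (measurable_posPow_measure_closedBall ν q r)]
  simp [posPow_mul hq hc]

/-- A ball of radius `2r` is covered by the balls of radius `r` about `x - r` and `x + r`, and
Lebesgue measure is translation invariant. -/
theorem ballMoment_two_mul_le (ν : Measure ℝ) [SFinite ν] {q : ℝ} (hq : 0 ≤ q) (r : ℝ) :
    ballMoment ν q (2 * r) ≤ 2 ^ q * 2 * ballMoment ν q r := by
  have hm := measurable_posPow_measure_closedBall ν q r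
  calc ballMoment ν q (2 * r)
      ≤ ∫⁻ x, 2 ^ q * (posPow q (ν (Metric.closedBall (x - r) r)) +
          posPow q (ν (Metric.closedBall (x + r) r))) := by
        refine lintegral_mono fun x => (posPow_mono hq ?_).trans (posPow_add_le hq _ _)
        refine (measure_mono ?_).trans (measure_union_le _ _)
        simp only [Real.closedBall_eq_Icc]
        intro z hz
        rcases le_total z x with h | h
        · left; constructor <;> linarith [hz.1]
        · right; constructor <;> linarith [hz.2]
    _ = 2 ^ q * ((∫⁻ x, posPow q (ν (Metric.closedBall (x - r) r))) +
          ∫⁻ x, posPow q (ν (Metric.closedBall (x + r) r))) := by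
        have h1 : Measurable fun x => posPow q (ν (Metric.closedBall (x - r) r)) :=
          hm.comp (measurable_sub_const r)
        have h2 : Measurable fun x => posPow q (ν (Metric.closedBall (x + r) r)) :=
          hm.comp (measurable_add_const r)
        rw [lintegral_const_mul _ (by fun_prop), lintegral_add_left h1]
    _ = 2 ^ q * (ballMoment ν q r + ballMoment ν q r) := by
        rw [lintegral_sub_right_eq_self (fun x => posPow q (ν (Metric.closedBall x r))) r,
          lintegral_add_right_eq_self (fun x => posPow q (ν (Metric.closedBall x r))) r]
        rfl
    _ = _ := by rw [← two_mul, mul_assoc]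

/-- Iterated doubling. The constant depends on `q` and `K` only, so it is uniform over all measures
and scales. -/
theorem exists_ballMoment_mul_le {q : ℝ} (hq : 0 ≤ q) (K : ℝ) :
    ∃ C : ℝ≥0∞, C ≠ ∞ ∧ ∀ (ν : Measure ℝ) [SFinite ν] (r : ℝ), 0 ≤ r →
      ballMoment ν q (K * r) ≤ C * ballMoment ν q r := by
  obtain ⟨n, hn⟩ := pow_unbounded_of_one_lt K one_lt_two
  refine ⟨(2 ^ q * 2) ^ n, ENNReal.pow_ne_top (ENNReal.mul_ne_top
    (ENNReal.rpow_ne_top_of_nonneg hq (by simp)) (by simp)), fun ν _ r hr => ?_⟩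
  refine (ballMoment_mono ν hq (mul_le_mul_of_nonneg_right hn.le hr)).trans ?_
  clear hn
  induction n with
  | zero => simp
  | succ n ih =>
    calc ballMoment ν q (2 ^ (n + 1) * r) = ballMoment ν q (2 * (2 ^ n * r)) := by
          congr 1; ring
      _ ≤ 2 ^ q * 2 * ballMoment ν q (2 ^ n * r) := ballMoment_two_mul_le ν hq _
      _ ≤ 2 ^ q * 2 * ((2 ^ q * 2) ^ n * ballMoment ν q r) := by gcongr
      _ = _ := by ring

theorem lintegral_affine (g : ℝ → ℝ≥0∞) (hg : Measurable g) {c : ℝ} (hc : c ≠ 0) (t : ℝ) :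
    ∫⁻ x, g ((x - t) / c) = ENNReal.ofReal |c| * ∫⁻ x, g x := by
  rw [lintegral_sub_right_eq_self (fun x => g (x / c)) t]
  conv_lhs => rw [← Real.smul_map_volume_mul_left hc]
  rw [lintegral_smul_measure, lintegral_map (by fun_prop) (by fun_prop), smul_eq_mul]
  congr 1
  refine lintegral_congr fun x => ?_
  rw [mul_div_cancel_left₀ _ hc]

theorem map_affine_closedBall (ν : Measure ℝ) {c : ℝ} (hc : c ≠ 0) (t x r : ℝ) :
    ν.map (fun y => c * y + t) (Metric.closedBall x r) =
      ν (Metric.closedBall ((x - t) / c) (r / |c|)) := by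
  rw [Measure.map_apply (by fun_prop) Metric.isClosed_closedBall.measurableSet]
  congr 1
  ext y
  have hc' : 0 < |c| := abs_pos.2 hc
  simp only [Set.mem_preimage, Metric.mem_closedBall, Real.dist_eq]
  rw [le_div_iff₀ hc', ← abs_mul, sub_mul, div_mul_cancel₀ _ hc]
  ring_nf

theorem ballMoment_map_affine (ν : Measure ℝ) [SFinite ν] (q : ℝ) {c : ℝ} (hc : c ≠ 0) (t r : ℝ) :
    ballMoment (ν.map fun y => c * y + t) q r =
      ENNReal.ofReal |c| * ballMoment ν q (r / |c|) := by
  unfold ballMoment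
  simp only [map_affine_closedBall ν hc]
  exact lintegral_affine (fun z => posPow q (ν (Metric.closedBall z (r / |c|))))
    (measurable_posPow_measure_closedBall ν q _) hc t

/-- Tonelli: each `x` lies in the ball about `y` for a set of `y` of length `2r`. This turns local
estimates around `y` into global ones. -/
theorem lintegral_lintegral_closedBall (g : ℝ → ℝ≥0∞) (hg : Measurable g) (r : ℝ) :
    ∫⁻ y, ∫⁻ x in Metric.closedBall y r, g x = ENNReal.ofReal (2 * r) * ∫⁻ x, g x := by
  have hm : MeasurableSet {z : ℝ × ℝ | dist z.2 z.1 ≤ r} :=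
    (isClosed_le (by fun_prop) (by fun_prop)).measurableSet
  have hF : Measurable ({z : ℝ × ℝ | dist z.2 z.1 ≤ r}.indicator fun z => g z.2) :=
    (hg.comp measurable_snd).indicator hm
  have h1 : ∀ y, ∫⁻ x in Metric.closedBall y r, g x =
      ∫⁻ x, {z : ℝ × ℝ | dist z.2 z.1 ≤ r}.indicator (fun z => g z.2) (y, x) := fun y => by
    rw [← lintegral_indicator Metric.isClosed_closedBall.measurableSet]
    rfl
  simp only [h1]
  rw [lintegral_lintegral_swap (f := fun y x =>
    {z : ℝ × ℝ | dist z.2 z.1 ≤ r}.indicator (fun z => g z.2) (y, x)) hF.aemeasurable,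
    ← lintegral_const_mul _ hg]
  refine lintegral_congr fun x => ?_
  calc _ = ∫⁻ y, (Metric.closedBall x r).indicator (fun _ => g x) y := by
        refine lintegral_congr fun y => ?_
        simp only [Set.indicator, Set.mem_ofPred_eq, Metric.mem_closedBall, dist_comm x y]
    _ = _ := by
        rw [lintegral_indicator Metric.isClosed_closedBall.measurableSet, setLIntegral_const,
          Real.volume_closedBall, mul_comm]

theorem ballMoment_ne_top (ν : Measure ℝ) [IsProbabilityMeasure ν] {q : ℝ} (hq : 0 ≤ q) {R : ℝ}
    (hR : ν (Metric.closedBall 0 R)ᶜ = 0) (r : ℝ) : ballMoment ν q r ≠ ∞ := by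
  have h : ballMoment ν q r ≤ ∫⁻ x, (Metric.closedBall (0 : ℝ) (R + r)).indicator (fun _ => 1) x := by
    refine lintegral_mono fun x => ?_
    by_cases hx : x ∈ Metric.closedBall (0 : ℝ) (R + r)
    · simp only [Set.indicator, hx, if_true]
      exact (posPow_mono hq prob_le_one).trans (posPow_one q).le
    · have : ν (Metric.closedBall x r) = 0 := by
        refine measure_mono_null (t := (Metric.closedBall 0 R)ᶜ) (fun z hz hz' => hx ?_) hR
        rw [Metric.mem_closedBall] at *
        linarith [dist_triangle_left x 0 z]
      simp [this]
  refine (h.trans_lt ?_).ne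
  rw [lintegral_indicator Metric.isClosed_closedBall.measurableSet, setLIntegral_const,
    Real.volume_closedBall, one_mul]
  exact ENNReal.ofReal_lt_top

/-- At radius `R + 1` every ball centred in `[-1, 1]` has full measure, so the moment there is at
least `2`; doubling carries positivity down to `r`. -/
theorem ballMoment_ne_zero (ν : Measure ℝ) [IsProbabilityMeasure ν] {q : ℝ} (hq : 0 ≤ q) {R : ℝ}
    (hR : ν (Metric.closedBall 0 R)ᶜ = 0) {r : ℝ} (hr : 0 < r) : ballMoment ν q r ≠ 0 := by
  intro h0
  obtain ⟨C, -, hC⟩ := exists_ballMoment_mul_le hq ((R + 1) / r)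
  have h1 := hC ν r hr.le
  rw [h0, mul_zero, div_mul_cancel₀ _ hr.ne'] at h1
  have h2 : ∫⁻ x, (Metric.closedBall (0 : ℝ) 1).indicator (fun _ => 1) x ≤
      ballMoment ν q (R + 1) := by
    refine lintegral_mono fun x => ?_
    by_cases hx : x ∈ Metric.closedBall (0 : ℝ) 1
    · simp only [Set.indicator, hx, if_true]
      have : ν (Metric.closedBall x (R + 1)) = 1 := by
        rw [prob_compl_eq_zero_iff Metric.isClosed_closedBall.measurableSet] at hR
        refine le_antisymm prob_le_one (hR ▸ measure_mono fun z hz => ?_)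
        rw [Metric.mem_closedBall] at *
        linarith [dist_triangle_right z x 0]
      simp [this]
    · simp [Set.indicator, hx]
  rw [lintegral_indicator Metric.isClosed_closedBall.measurableSet, setLIntegral_const,
    Real.volume_closedBall, one_mul] at h2
  have := h2.trans h1
  norm_num at this

/-! ### Comparison with mesh sums -/

/-- The mesh sum as an extended non-negative number. -/
def meshMoment (ν : Measure ℝ) (q δ : ℝ) : ℝ≥0∞ :=
  ∑' k : ℤ, posPow q (ν (Set.Icc (k * δ) ((k + 1) * δ)))

theorem toReal_meshMoment (ν : Measure ℝ) [IsFiniteMeasure ν] {q : ℝ} (hq : 0 ≤ q) (δ : ℝ) :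
    (meshMoment ν q δ).toReal = meshSum ν q δ := by
  unfold meshMoment meshSum
  rw [ENNReal.tsum_toReal_eq fun k => posPow_ne_top hq (measure_ne_top _ _)]
  refine tsum_congr fun k => ?_
  unfold posPow
  split_ifs
  · rfl
  · rw [← ENNReal.toReal_rpow]; rfl

theorem lintegral_eq_tsum_mesh (g : ℝ → ℝ≥0∞) {δ : ℝ} (hδ : 0 < δ) :
    ∫⁻ x, g x = ∑' k : ℤ, ∫⁻ x in Set.Ico (k * δ) ((k + 1) * δ), g x := by
  have h := iUnion_Ico_zsmul hδ
  have hd := Set.pairwise_disjoint_Ico_zsmul δ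
  simp only [zsmul_eq_mul, Int.cast_add, Int.cast_one] at h hd
  rw [← setLIntegral_univ, ← h, lintegral_iUnion (fun k => measurableSet_Ico) hd]

theorem mul_meshMoment_le (ν : Measure ℝ) {q : ℝ} (hq : 0 ≤ q) {δ : ℝ} (hδ : 0 < δ) :
    ENNReal.ofReal δ * meshMoment ν q δ ≤ ballMoment ν q δ := by
  unfold meshMoment ballMoment
  rw [lintegral_eq_tsum_mesh _ hδ, ← ENNReal.tsum_mul_left]
  refine ENNReal.tsum_le_tsum fun k => ?_
  calc _ = ∫⁻ x in Set.Ico (k * δ) ((k + 1) * δ),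
        posPow q (ν (Set.Icc (k * δ) ((k + 1) * δ))) := by
        rw [setLIntegral_const, Real.volume_Ico, mul_comm]
        congr 2; ring
    _ ≤ _ := by
        refine setLIntegral_mono' measurableSet_Ico fun x hx => posPow_mono hq (measure_mono ?_)
        rw [Real.closedBall_eq_Icc]
        intro z hz
        constructor <;> nlinarith [hx.1, hx.2, hz.1, hz.2]

/-- A ball of radius `δ` centred in a mesh interval lies in that interval and its two neighbours.
Splitting the three masses costs `2 ^ q` twice, and summing the shifted series gives the factor `3`.
-/
theorem ballMoment_le_mul_meshMoment (ν : Measure ℝ) {q : ℝ} (hq : 0 ≤ q) {δ : ℝ} (hδ : 0 < δ) :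
    ballMoment ν q δ ≤ 2 ^ q * 2 ^ q * 3 * (ENNReal.ofReal δ * meshMoment ν q δ) := by
  set m : ℤ → ℝ≥0∞ := fun k => posPow q (ν (Set.Icc (k * δ) ((k + 1) * δ))) with hm
  -- The third interval is split off once only, so its missing factor `2 ^ q` has to be padded.
  have one_le : (1 : ℝ≥0∞) ≤ 2 ^ q := by
    simpa using ENNReal.rpow_le_rpow one_le_two hq
  have key : ∀ k : ℤ, ∫⁻ x in Set.Ico (k * δ) ((k + 1) * δ),
      posPow q (ν (Metric.closedBall x δ)) ≤
      2 ^ q * 2 ^ q * ENNReal.ofReal δ * (m (k - 1) + m k + m (k + 1)) := fun k => by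
    calc _ ≤ ∫⁻ x in Set.Ico (k * δ) ((k + 1) * δ),
          2 ^ q * 2 ^ q * (m (k - 1) + m k + m (k + 1)) := by
          refine setLIntegral_mono' measurableSet_Ico fun x hx => ?_
          have hsub : Metric.closedBall x δ ⊆ (Set.Icc (((k - 1 : ℤ) : ℝ) * δ)
              ((((k - 1 : ℤ) : ℝ) + 1) * δ) ∪ Set.Icc (k * δ) ((k + 1) * δ)) ∪
              Set.Icc (((k + 1 : ℤ) : ℝ) * δ) ((((k + 1 : ℤ) : ℝ) + 1) * δ) := by
            rw [Real.closedBall_eq_Icc]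
            intro z hz
            push_cast
            rcases le_total z (k * δ) with h | h
            · left; left; constructor <;> nlinarith [hx.1, hx.2, hz.1, hz.2]
            · rcases le_total z ((k + 1) * δ) with h' | h'
              · left; right; exact ⟨h, h'⟩
              · right; constructor <;> nlinarith [hx.1, hx.2, hz.1, hz.2]
          refine (posPow_mono hq ((measure_mono hsub).trans ((measure_union_le _ _).trans
            (add_le_add_left (measure_union_le _ _) _)))).trans ?_
          refine (posPow_add_le hq _ _).trans ?_
          rw [mul_assoc]
          gcongr
          rw [mul_add]
          gcongr
          · exact posPow_add_le hq _ _
          · exact le_mul_of_one_le_left zero_le one_le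
      _ = _ := by
          rw [setLIntegral_const, Real.volume_Ico]
          have : ((k : ℝ) + 1) * δ - k * δ = δ := by ring
          rw [this]; ring
  unfold ballMoment meshMoment
  rw [lintegral_eq_tsum_mesh _ hδ]
  refine (ENNReal.tsum_le_tsum key).trans ?_
  rw [ENNReal.tsum_mul_left, ENNReal.tsum_add, ENNReal.tsum_add]
  have h1 : ∑' k, m (k - 1) = ∑' k, m k := (Equiv.subRight (1 : ℤ)).tsum_eq m
  have h2 : ∑' k, m (k + 1) = ∑' k, m k := (Equiv.addRight (1 : ℤ)).tsum_eq m
  rw [h1, h2]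
  apply le_of_eq
  ring

/-! ### Moments of mixtures of localized measures -/

section Mixture

variable {J : Type*} [Fintype J] {p : J → ℝ≥0∞} {κ : J → Measure ℝ} {t : J → ℝ} {ν : Measure ℝ}
  {r : ℝ}

theorem mixture_apply (hν : ν = ∑ j, p j • κ j) (s : Set ℝ) : ν s = ∑ j, p j * κ j s := by
  simp [hν]

theorem sum_weights_le_measure [∀ j, IsProbabilityMeasure (κ j)] (hν : ν = ∑ j, p j • κ j)
    (hκ : ∀ j, κ j (Metric.closedBall (t j) r)ᶜ = 0) (W : Finset J) {s : Set ℝ}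
    (hW : ∀ j ∈ W, Metric.closedBall (t j) r ⊆ s) : ∑ j ∈ W, p j ≤ ν s := by
  rw [mixture_apply hν]
  refine le_trans ?_ (Finset.sum_le_sum_of_subset (Finset.subset_univ W))
  refine Finset.sum_le_sum fun j hj => ?_
  have h1 := (prob_compl_eq_zero_iff Metric.isClosed_closedBall.measurableSet).1 (hκ j)
  have h2 : 1 ≤ κ j s := h1 ▸ measure_mono (hW j hj)
  exact le_mul_of_one_le_right zero_le h2

theorem measure_closedBall_eq_zero {κ : Measure ℝ} {t r : ℝ}
    (hκ : κ (Metric.closedBall t r)ᶜ = 0) {x a : ℝ} (h : r + a < dist x t) :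
    κ (Metric.closedBall x a) = 0 := by
  refine measure_mono_null (t := (Metric.closedBall t r)ᶜ) (fun z hz hz' => ?_) hκ
  rw [Metric.mem_closedBall] at *
  linarith [dist_triangle_left x t z]

theorem mixture_apply_closedBall (hν : ν = ∑ j, p j • κ j)
    (hκ : ∀ j, κ j (Metric.closedBall (t j) r)ᶜ = 0) (W : Finset J) {x a : ℝ}
    (hW : ∀ j, j ∉ W → r + a < dist x (t j)) :
    ν (Metric.closedBall x a) = ∑ j ∈ W, p j * κ j (Metric.closedBall x a) := by
  rw [mixture_apply hν]
  refine (Finset.sum_subset (Finset.subset_univ W) fun j _ hj => ?_).symm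
  rw [measure_closedBall_eq_zero (hκ j) (hW j hj), mul_zero]

variable [∀ j, IsProbabilityMeasure (κ j)] [IsProbabilityMeasure ν]

theorem sum_weights_ne_top (hν : ν = ∑ j, p j • κ j)
    (hκ : ∀ j, κ j (Metric.closedBall (t j) r)ᶜ = 0) (W : Finset J) : ∑ j ∈ W, p j ≠ ∞ :=
  ((sum_weights_le_measure hν hκ W (s := Set.univ) fun _ _ => Set.subset_univ _).trans_lt
    (measure_lt_top ν _)).ne

/-- Near `y` only components centred close to `y` are seen. Jensen bounds their moment by the `q`-th
power of their total weight, which is at most the `ν`-mass of a larger ball about `y`; integrating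
over `y` gives the claim. -/
theorem ballMoment_mixture_le {q : ℝ} (hq : 1 ≤ q) (hν : ν = ∑ j, p j • κ j)
    (hκ : ∀ j, κ j (Metric.closedBall (t j) r)ᶜ = 0) {r' : ℝ} (hr : r' ≤ r) (N : ℝ≥0∞)
    (hN : ∀ j, ballMoment (κ j) q r' ≤ N) :
    ENNReal.ofReal (2 * r) * ballMoment ν q r' ≤ N * ballMoment ν q (4 * r) := by
  classical
  have hq0 : 0 ≤ q := zero_le_one.trans hq
  unfold ballMoment
  rw [← lintegral_lintegral_closedBall _ (measurable_posPow_measure_closedBall ν q r'),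
    ← lintegral_const_mul _ (measurable_posPow_measure_closedBall ν q (4 * r))]
  refine lintegral_mono fun y => ?_
  -- With `x` within `r` of `y`, a component meeting the ball of radius `r' ≤ r` about `x` is
  -- centred within `3r` of `y`, and its support then lies within `4r`.
  set W : Finset J := Finset.univ.filter fun j => dist y (t j) ≤ 3 * r with hWdef
  calc ∫⁻ x in Metric.closedBall y r, posPow q (ν (Metric.closedBall x r'))
      = ∫⁻ x in Metric.closedBall y r,
          posPow q (∑ j ∈ W, p j * κ j (Metric.closedBall x r')) := by
        refine setLIntegral_congr_fun Metric.isClosed_closedBall.measurableSet fun x hx => ?_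
        rw [mixture_apply_closedBall hν hκ W fun j hj => ?_]
        rw [Metric.mem_closedBall] at hx
        simp only [hWdef, Finset.mem_filter, Finset.mem_univ, true_and, not_le] at hj
        linarith [dist_triangle_left y (t j) x]
    _ ≤ ∫⁻ x, posPow q (∑ j ∈ W, p j * κ j (Metric.closedBall x r')) :=
        setLIntegral_le_lintegral _ _
    _ ≤ posPow q (∑ j ∈ W, p j) * N :=
        lintegral_posPow_sum_le W hq p (sum_weights_ne_top hν hκ W) _
          (fun j => measurable_measure_closedBall (κ j) r') N fun j _ => hN j
    _ ≤ N * posPow q (ν (Metric.closedBall y (4 * r))) := by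
        rw [mul_comm]
        gcongr
        refine posPow_mono hq0 (sum_weights_le_measure hν hκ W fun j hj z hz => ?_)
        simp only [hWdef, Finset.mem_filter, Finset.mem_univ, true_and] at hj
        rw [Metric.mem_closedBall] at *
        linarith [dist_triangle_right z y (t j)]

/-- Dual to `ballMoment_mixture_le`: for `q ≤ 1` the components near `y` carry at least the mass of
the ball about `y`, and concavity bounds their moment below. -/
theorem le_ballMoment_mixture {q : ℝ} (hq : 0 ≤ q) (hq1 : q ≤ 1) (hν : ν = ∑ j, p j • κ j)
    (hκ : ∀ j, κ j (Metric.closedBall (t j) r)ᶜ = 0) {r' : ℝ} (hr : r' ≤ r) (N : ℝ≥0∞)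
    (hN : ∀ j, N ≤ ballMoment (κ j) q r') :
    N * ballMoment ν q r ≤ ENNReal.ofReal (8 * r) * ballMoment ν q r' := by
  classical
  have h8 : 8 * r = 2 * (4 * r) := by ring
  unfold ballMoment
  rw [h8, ← lintegral_lintegral_closedBall _ (measurable_posPow_measure_closedBall ν q r'),
    ← lintegral_const_mul _ (measurable_posPow_measure_closedBall ν q r)]
  refine lintegral_mono fun y => ?_
  -- Components meeting the ball of radius `r` about `y` are centred within `2r`; balls of radius
  -- `r'` that see them are centred within `2r + r + r' ≤ 4r`, whence the constant `8 = 2 · 4`.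
  set W : Finset J := Finset.univ.filter fun j => dist y (t j) ≤ 2 * r with hWdef
  have hle : ν (Metric.closedBall y r) ≤ ∑ j ∈ W, p j := by
    rw [mixture_apply_closedBall hν hκ W fun j hj => ?_]
    · exact Finset.sum_le_sum fun j _ => mul_le_of_le_one_right zero_le prob_le_one
    · simp only [hWdef, Finset.mem_filter, Finset.mem_univ, true_and, not_le] at hj
      linarith
  calc N * posPow q (ν (Metric.closedBall y r)) ≤ posPow q (∑ j ∈ W, p j) * N := by
        rw [mul_comm]
        gcongr
        exact posPow_mono hq hle
    _ ≤ ∫⁻ x, posPow q (∑ j ∈ W, p j * κ j (Metric.closedBall x r')) :=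
        le_lintegral_posPow_sum W hq hq1 p (sum_weights_ne_top hν hκ W) _
          (fun j => measurable_measure_closedBall (κ j) r') N fun j _ => hN j
    _ ≤ ∫⁻ x, (Metric.closedBall y (4 * r)).indicator
          (fun x => posPow q (ν (Metric.closedBall x r'))) x := by
        refine lintegral_mono fun x => ?_
        by_cases hx : x ∈ Metric.closedBall y (4 * r)
        · simp only [Set.indicator, hx, if_true]
          rw [mixture_apply hν]
          exact posPow_mono hq (Finset.sum_le_sum_of_subset (Finset.subset_univ W))
        · have : ∑ j ∈ W, p j * κ j (Metric.closedBall x r') = 0 := by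
            refine Finset.sum_eq_zero fun j hj => ?_
            rw [measure_closedBall_eq_zero (hκ j), mul_zero]
            simp only [hWdef, Finset.mem_filter, Finset.mem_univ, true_and] at hj
            rw [Metric.mem_closedBall] at hx
            linarith [dist_triangle_right x y (t j)]
          simp [this]
    _ = _ := lintegral_indicator Metric.isClosed_closedBall.measurableSet _

end Mixture

/-! ### Graph-directed self-similar families on the line -/

/-- A family of compactly supported probability measures on the line with
`ν s = ∑ p_e ν_{t(e)} ∘ f_e⁻¹`, the sum over the edges `e` leaving `s`, where
`f_e x = c_e x + t_e` are contracting similarities. -/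
structure IsSelfSimilarFamily {S E : Type*} [DecidableEq S] [Fintype E] (src tgt : E → S)
    (p : E → ℝ≥0∞) (c t : E → ℝ) (ν : S → Measure ℝ) : Prop where
  isProbability : ∀ s, IsProbabilityMeasure (ν s)
  bounded : ∃ R : ℝ, ∀ s, ν s (Metric.closedBall 0 R)ᶜ = 0
  weight_ne_zero : ∀ e, p e ≠ 0
  weight_ne_top : ∀ e, p e ≠ ∞
  ratio_ne_zero : ∀ e, c e ≠ 0
  ratio_lt_one : ∀ e, |c e| < 1
  selfSimilar : ∀ s, ν s = ∑ e with src e = s, p e • (ν (tgt e)).map fun x => c e * x + t e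

/-- There is a directed path, possibly of length zero, between two vertices. -/
def Reach {S E : Type*} (src tgt : E → S) : S → S → Prop :=
  Relation.ReflTransGen fun u u' => ∃ e, src e = u ∧ tgt e = u'

theorem exists_pos_le_abs {E : Type*} [Finite E] {c : E → ℝ} (hc : ∀ e, c e ≠ 0) :
    ∃ ρ : ℝ, 0 < ρ ∧ ρ ≤ 1 ∧ ∀ e, ρ ≤ |c e| := by
  cases isEmpty_or_nonempty E
  · exact ⟨1, one_pos, le_rfl, isEmptyElim⟩
  · obtain ⟨e₀, he₀⟩ := Finite.exists_min fun e => |c e|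
    exact ⟨min 1 |c e₀|, lt_min one_pos (abs_pos.2 (hc e₀)), min_le_left _ _,
      fun e => (min_le_right _ _).trans (he₀ e)⟩

theorem exists_abs_le_lt_one {E : Type*} [Finite E] {c : E → ℝ} (hc : ∀ e, |c e| < 1) :
    ∃ θ : ℝ, 0 < θ ∧ θ < 1 ∧ ∀ e, |c e| ≤ θ := by
  cases isEmpty_or_nonempty E
  · exact ⟨1 / 2, by norm_num, by norm_num, isEmptyElim⟩
  · obtain ⟨e₀, he₀⟩ := Finite.exists_max fun e => |c e|
    exact ⟨max (1 / 2) |c e₀|, lt_max_of_lt_left (by norm_num), max_lt (by norm_num) (hc e₀),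
      fun e => (he₀ e).trans (le_max_right _ _)⟩

namespace IsSelfSimilarFamily

universe uE

variable {S : Type*} {E : Type uE} [DecidableEq S] [Fintype E] {src tgt : E → S} {p : E → ℝ≥0∞}
  {c t : E → ℝ} {ν : S → Measure ℝ}

/-- At every scale `δ`, each member of the family is a mixture of similar copies of members of the
family by ratios comparable to `δ`. -/
theorem exists_decomposition (h : IsSelfSimilarFamily src tgt p c t ν) :
    ∃ ρ : ℝ, 0 < ρ ∧ ∀ δ, 0 < δ → δ ≤ 1 → ∀ s, ∃ (J : Type uE) (_ : Fintype J) (w : J → ℝ≥0∞)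
      (u : J → S) (a b : J → ℝ), (∀ j, Reach src tgt s (u j)) ∧
      (∀ j, ρ * δ ≤ |a j| ∧ |a j| ≤ δ) ∧
      ν s = ∑ j, w j • (ν (u j)).map fun x => a j * x + b j := by
  obtain ⟨ρ, hρ, hρ1, hρc⟩ := exists_pos_le_abs h.ratio_ne_zero
  obtain ⟨θ, hθ, hθ1, hθc⟩ := exists_abs_le_lt_one h.ratio_lt_one
  refine ⟨ρ, hρ, ?_⟩
  -- Stopping rule: once the rescaled `δ` is at least `1`, the measure itself is kept, with ratio
  -- `1`. The bound `ρ * δ ≤ 1` records that the last edge did not overshoot.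
  have base : ∀ δ, 1 ≤ δ → ρ * δ ≤ 1 → ∀ s, ∃ (J : Type uE) (_ : Fintype J) (w : J → ℝ≥0∞)
      (u : J → S) (a b : J → ℝ), (∀ j, Reach src tgt s (u j)) ∧
      (∀ j, ρ * δ ≤ |a j| ∧ |a j| ≤ δ) ∧
      ν s = ∑ j, w j • (ν (u j)).map fun x => a j * x + b j := fun δ h1 h2 s =>
    ⟨PUnit, inferInstance, fun _ => 1, fun _ => s, fun _ => 1, fun _ => 0,
      fun _ => Relation.ReflTransGen.refl, fun _ => by simp [h1, h2], by simp⟩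
  have key : ∀ n : ℕ, ∀ δ, θ ^ n ≤ δ → ρ * δ ≤ 1 → ∀ s, ∃ (J : Type uE) (_ : Fintype J)
      (w : J → ℝ≥0∞) (u : J → S) (a b : J → ℝ), (∀ j, Reach src tgt s (u j)) ∧
      (∀ j, ρ * δ ≤ |a j| ∧ |a j| ≤ δ) ∧
      ν s = ∑ j, w j • (ν (u j)).map fun x => a j * x + b j := by
    intro n
    induction n with
    | zero => exact fun δ h1 h2 => base δ (by simpa using h1) h2
    | succ n ih =>
      intro δ h1 h2 s
      rcases le_total 1 δ with h3 | h3
      · exact base δ h3 h2 s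
      have hδ : 0 < δ := (pow_pos hθ _).trans_le h1
      -- Expanding along one edge replaces `δ` by `δ / |c e|`. Since `|c e| ≤ θ`, one power of `θ`
      -- is used up, so the induction ends.
      have step := fun e : {e // src e = s} => ih (δ / |c e|)
        (by
          rw [le_div_iff₀ (abs_pos.2 (h.ratio_ne_zero e))]
          refine le_trans ?_ h1
          rw [pow_succ]
          gcongr
          exact hθc e)
        (by
          rw [← mul_div_assoc, div_le_one (abs_pos.2 (h.ratio_ne_zero e))]
          nlinarith [hρc e]) (tgt e)
      choose J hJ w u a b hu ha hν using step
      refine ⟨Σ e : {e // src e = s}, J e, inferInstance, fun j => p j.1 * w j.1 j.2,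
        fun j => u j.1 j.2, fun j => c j.1 * a j.1 j.2, fun j => c j.1 * b j.1 j.2 + t j.1,
        fun j => (hu j.1 j.2).head ⟨j.1, j.1.2, rfl⟩, fun j => ?_, ?_⟩
      · have hc : 0 < |c j.1| := abs_pos.2 (h.ratio_ne_zero j.1)
        obtain ⟨h4, h5⟩ := ha j.1 j.2
        rw [abs_mul]
        constructor
        · calc ρ * δ = |c j.1| * (ρ * (δ / |c j.1|)) := by field_simp
            _ ≤ _ := by gcongr
        · calc |c j.1| * |a j.1 j.2| ≤ |c j.1| * (δ / |c j.1|) := by gcongr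
            _ = δ := by field_simp
      · conv_lhs => rw [h.selfSimilar s]
        rw [Finset.sum_subtype (p := fun e => src e = s) _ (by simp), Fintype.sum_sigma]
        refine Finset.sum_congr rfl fun e _ => ?_
        conv_lhs => rw [hν e]
        rw [Measure.map_finset_sum (by fun_prop), Finset.smul_sum]
        refine Finset.sum_congr rfl fun j _ => ?_
        rw [Measure.map_smul, Measure.map_map (by fun_prop) (by fun_prop), smul_smul]
        congr 2
        funext x
        simp only [Function.comp_apply]
        ring
  intro δ hδ hδ1 s
  obtain ⟨n, hn⟩ := exists_pow_lt_of_lt_one hδ hθ1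
  exact key n δ hn.le (by nlinarith) s

/-- Along an edge, `ν (src e)` dominates a weighted similar copy of `ν (tgt e)`, and contraction
only enlarges the radius at which the latter is evaluated. -/
theorem exists_ballMoment_le_of_reach (h : IsSelfSimilarFamily src tgt p c t ν) {q : ℝ}
    (hq : 0 ≤ q) {s u : S} (hsu : Reach src tgt s u) :
    ∃ C : ℝ≥0∞, C ≠ ∞ ∧ ∀ r, 0 ≤ r → ballMoment (ν u) q r ≤ C * ballMoment (ν s) q r := by
  have := h.isProbability
  induction hsu with
  | refl => exact ⟨1, by simp, fun r _ => by simp⟩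
  | tail _ he ih =>
    obtain ⟨C, hC, hle⟩ := ih
    obtain ⟨e, rfl, rfl⟩ := he
    have hc : 0 < |c e| := abs_pos.2 (h.ratio_ne_zero e)
    set x : ℝ≥0∞ := p e ^ q * ENNReal.ofReal |c e| with hx
    have hx0 : x ≠ 0 := mul_ne_zero (fun h0 => by
      rcases ENNReal.rpow_eq_zero_iff.1 h0 with h1 | h1
      · exact h.weight_ne_zero e h1.1
      · linarith [h1.2]) (by simpa using h.ratio_ne_zero e)
    have hxt : x ≠ ∞ := ENNReal.mul_ne_top
      (ENNReal.rpow_ne_top_of_nonneg hq (h.weight_ne_top e)) ENNReal.ofReal_ne_top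
    refine ⟨x⁻¹ * C, ENNReal.mul_ne_top (ENNReal.inv_ne_top.2 hx0) hC, fun r hr => ?_⟩
    have h1 : p e • (ν (tgt e)).map (fun x => c e * x + t e) ≤ ν (src e) := by
      rw [h.selfSimilar (src e)]
      exact Finset.single_le_sum (f := fun e => p e • (ν (tgt e)).map (fun x => c e * x + t e))
        (fun _ _ => Measure.zero_le _) (by simp)
    have h2 : x * ballMoment (ν (tgt e)) q r ≤ ballMoment (ν (src e)) q r := by
      refine le_trans ?_ (ballMoment_mono_measure h1 hq r)
      rw [ballMoment_smul _ hq (h.weight_ne_zero e),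
        ballMoment_map_affine _ _ (h.ratio_ne_zero e), hx, mul_assoc]
      gcongr
      exact ballMoment_mono _ hq (le_div_self hr hc (h.ratio_lt_one e).le)
    rw [mul_assoc, ← ENNReal.mul_le_iff_le_inv hx0 hxt]
    exact h2.trans (hle r hr)

theorem map_affine_compl_closedBall {ν : Measure ℝ} {R : ℝ} (hR : ν (Metric.closedBall 0 R)ᶜ = 0)
    {a δ : ℝ} (ha : |a| ≤ δ) (hR0 : 0 ≤ R) (b : ℝ) :
    ν.map (fun x => a * x + b) (Metric.closedBall b (R * δ))ᶜ = 0 := by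
  rw [Measure.map_apply (by fun_prop) Metric.isClosed_closedBall.measurableSet.compl]
  refine measure_mono_null (t := (Metric.closedBall 0 R)ᶜ) (fun x hx hx' => hx ?_) hR
  simp only [Metric.mem_closedBall, Real.dist_eq, sub_zero, add_sub_cancel_right, abs_mul] at *
  rw [mul_comm]
  gcongr

theorem exists_radius (h : IsSelfSimilarFamily src tgt p c t ν) :
    ∃ R : ℝ, 1 ≤ R ∧ ∀ s, ν s (Metric.closedBall 0 R)ᶜ = 0 := by
  obtain ⟨R, hR⟩ := h.bounded
  -- A radius of at least `1` gives `δ * δ' ≤ R * δ`, as the mixture estimates require.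
  exact ⟨max 1 R, le_max_left _ _, fun s => measure_mono_null (Set.compl_subset_compl.2
    (Metric.closedBall_subset_closedBall (le_max_right _ _))) (hR s)⟩

variable [Finite S]

theorem exists_ballMoment_le_of_forall_reach (h : IsSelfSimilarFamily src tgt p c t ν) {q : ℝ}
    (hq : 0 ≤ q) : ∃ C : ℝ≥0∞, C ≠ ∞ ∧ ∀ s u, Reach src tgt s u → ∀ r, 0 ≤ r →
      ballMoment (ν u) q r ≤ C * ballMoment (ν s) q r := by
  have := Fintype.ofFinite S
  have h1 : ∀ z : S × S, ∃ C : ℝ≥0∞, C ≠ ∞ ∧ (Reach src tgt z.1 z.2 → ∀ r, 0 ≤ r →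
      ballMoment (ν z.2) q r ≤ C * ballMoment (ν z.1) q r) := fun z => by
    by_cases hz : Reach src tgt z.1 z.2
    · obtain ⟨C, hC, hle⟩ := h.exists_ballMoment_le_of_reach hq hz
      exact ⟨C, hC, fun _ => hle⟩
    · exact ⟨0, by simp, fun h => absurd h hz⟩
  choose C hC hle using h1
  refine ⟨∑ z, C z, ENNReal.sum_ne_top.2 fun z _ => hC z, fun s u hsu r hr => ?_⟩
  refine (hle (s, u) hsu r hr).trans ?_
  gcongr
  exact Finset.single_le_sum (f := C) (fun _ _ => zero_le) (Finset.mem_univ (s, u))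

/-- A copy with ratio `a j` comparable to `δ` has moment at scale `δ * δ'` comparable to `δ` times
that of `ν (u j)` at scale `δ'`. As `u j` is reachable from `s`, the latter is bounded by the moment
of `ν s`. -/
theorem exists_ballMoment_mul_le_mul (h : IsSelfSimilarFamily src tgt p c t ν) {q : ℝ}
    (hq : 1 ≤ q) (s : S) : ∃ K : ℝ≥0∞, K ≠ ∞ ∧ ∀ δ δ' : ℝ, 0 < δ → δ ≤ 1 → 0 < δ' → δ' ≤ 1 →
      ballMoment (ν s) q (δ * δ') ≤ K * (ballMoment (ν s) q δ * ballMoment (ν s) q δ') := by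
  have hprob := h.isProbability
  have hq0 : 0 ≤ q := zero_le_one.trans hq
  obtain ⟨R, hR1, hR⟩ := h.exists_radius
  obtain ⟨ρ, hρ, hdec⟩ := h.exists_decomposition
  obtain ⟨C₁, hC₁, h₁⟩ := exists_ballMoment_mul_le hq0 ρ⁻¹
  obtain ⟨C₂, hC₂, h₂⟩ := h.exists_ballMoment_le_of_forall_reach hq0
  obtain ⟨C₃, hC₃, h₃⟩ := exists_ballMoment_mul_le hq0 (4 * R)
  refine ⟨C₁ * C₂ * C₃, ENNReal.mul_ne_top (ENNReal.mul_ne_top hC₁ hC₂) hC₃, ?_⟩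
  intro δ δ' hδ hδ1 hδ' hδ'1
  obtain ⟨J, _, w, u, a, b, hu, ha, hν⟩ := hdec δ hδ hδ1 s
  have hpr : ∀ j, IsProbabilityMeasure ((ν (u j)).map fun x => a j * x + b j) := fun j =>
    Measure.isProbabilityMeasure_map (by fun_prop)
  have hmix := ballMoment_mixture_le (r' := δ * δ') hq hν
    (fun j => map_affine_compl_closedBall (hR (u j)) (ha j).2 (by linarith) (b j))
    (by nlinarith) (ENNReal.ofReal δ * (C₁ * (C₂ * ballMoment (ν s) q δ'))) fun j => by
      have ha0 : 0 < |a j| := (mul_pos hρ hδ).trans_le (ha j).1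
      rw [ballMoment_map_affine _ _ (abs_pos.1 ha0)]
      gcongr
      · exact (ha j).2
      · refine le_trans (ballMoment_mono _ hq0 ?_) ((h₁ (ν (u j)) δ' hδ'.le).trans ?_)
        · rw [div_le_iff₀ ha0]
          calc δ * δ' = ρ⁻¹ * δ' * (ρ * δ) := by field_simp
            _ ≤ _ := by gcongr; exact (ha j).1
        · gcongr
          exact h₂ s (u j) (hu j) δ' hδ'.le
  have hδ0 : ENNReal.ofReal δ ≠ 0 := by simpa using hδ
  rw [← ENNReal.mul_le_mul_iff_right hδ0 ENNReal.ofReal_ne_top]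
  calc ENNReal.ofReal δ * ballMoment (ν s) q (δ * δ')
      ≤ ENNReal.ofReal (2 * (R * δ)) * ballMoment (ν s) q (δ * δ') := by
        gcongr
        nlinarith
    _ ≤ _ := hmix
    _ ≤ ENNReal.ofReal δ * (C₁ * (C₂ * ballMoment (ν s) q δ')) *
          (C₃ * ballMoment (ν s) q δ) := by
        gcongr
        rw [← mul_assoc]
        exact h₃ (ν s) δ hδ.le
    _ = _ := by ring

/-- Here the moments of the pieces must be bounded below by that of `ν s`, which needs a path from
each piece back to `s`; hence `hs`. -/
theorem exists_mul_ballMoment_le (h : IsSelfSimilarFamily src tgt p c t ν) {q : ℝ}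
    (hq : 0 ≤ q) (hq1 : q ≤ 1) (s : S)
    (hs : ∀ u, Reach src tgt s u → Reach src tgt u s) :
    ∃ K : ℝ≥0∞, K ≠ ∞ ∧ ∀ δ δ' : ℝ, 0 < δ → δ ≤ 1 → 0 < δ' → δ' ≤ 1 →
      ballMoment (ν s) q δ * ballMoment (ν s) q δ' ≤ K * ballMoment (ν s) q (δ * δ') := by
  have hprob := h.isProbability
  obtain ⟨R, hR1, hR⟩ := h.exists_radius
  obtain ⟨ρ, hρ, hdec⟩ := h.exists_decomposition
  obtain ⟨C, hC, hle⟩ := h.exists_ballMoment_le_of_forall_reach hq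
  have hρ0 : ENNReal.ofReal ρ ≠ 0 := by simpa using hρ
  refine ⟨(C + 1) * (ENNReal.ofReal ρ)⁻¹ * ENNReal.ofReal (8 * R), ENNReal.mul_ne_top
    (ENNReal.mul_ne_top (ENNReal.add_ne_top.2 ⟨hC, by simp⟩) (ENNReal.inv_ne_top.2 hρ0))
    ENNReal.ofReal_ne_top, ?_⟩
  intro δ δ' hδ hδ1 hδ' hδ'1
  obtain ⟨J, _, w, u, a, b, hu, ha, hν⟩ := hdec δ hδ hδ1 s
  have hpr : ∀ j, IsProbabilityMeasure ((ν (u j)).map fun x => a j * x + b j) := fun j =>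
    Measure.isProbabilityMeasure_map (by fun_prop)
  -- `C` itself might vanish; `C + 1` can be inverted.
  have hC0 : C + 1 ≠ 0 := by simp
  have hCt : C + 1 ≠ ∞ := ENNReal.add_ne_top.2 ⟨hC, by simp⟩
  have hmix := le_ballMoment_mixture (r' := δ * δ') hq hq1 hν
    (fun j => map_affine_compl_closedBall (hR (u j)) (ha j).2 (by linarith) (b j))
    (by nlinarith) (ENNReal.ofReal (ρ * δ) * ((C + 1)⁻¹ * ballMoment (ν s) q δ')) fun j => by
      have ha0 : 0 < |a j| := (mul_pos hρ hδ).trans_le (ha j).1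
      rw [ballMoment_map_affine _ _ (abs_pos.1 ha0)]
      gcongr
      · exact (ha j).1
      · rw [ENNReal.inv_mul_le_iff hC0 hCt]
        refine (hle (u j) s (hs _ (hu j)) δ' hδ'.le).trans ?_
        gcongr
        · exact le_self_add
        · refine ballMoment_mono _ hq ?_
          rw [le_div_iff₀ ha0, mul_comm]
          gcongr
          exact (ha j).2
  have hδ0 : ENNReal.ofReal δ ≠ 0 := by simpa using hδ
  have hx0 : ENNReal.ofReal δ * ENNReal.ofReal ρ * (C + 1)⁻¹ ≠ 0 :=
    mul_ne_zero (mul_ne_zero hδ0 hρ0) (ENNReal.inv_ne_zero.2 hCt)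
  have hxt : ENNReal.ofReal δ * ENNReal.ofReal ρ * (C + 1)⁻¹ ≠ ∞ :=
    ENNReal.mul_ne_top (ENNReal.mul_ne_top ENNReal.ofReal_ne_top ENNReal.ofReal_ne_top)
      (ENNReal.inv_ne_top.2 hC0)
  rw [← ENNReal.mul_le_mul_iff_right hx0 hxt]
  calc ENNReal.ofReal δ * ENNReal.ofReal ρ * (C + 1)⁻¹ *
        (ballMoment (ν s) q δ * ballMoment (ν s) q δ')
      = ENNReal.ofReal (ρ * δ) * ((C + 1)⁻¹ * ballMoment (ν s) q δ') * ballMoment (ν s) q δ := by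
        rw [ENNReal.ofReal_mul hρ.le]; ring
    _ ≤ ENNReal.ofReal (ρ * δ) * ((C + 1)⁻¹ * ballMoment (ν s) q δ') *
          ballMoment (ν s) q (R * δ) := by
        gcongr
        exact ballMoment_mono _ hq (by nlinarith)
    _ ≤ _ := hmix
    _ = ENNReal.ofReal δ * ENNReal.ofReal (8 * R) * ballMoment (ν s) q (δ * δ') := by
        rw [← ENNReal.ofReal_mul hδ.le]
        congr 2; ring
    _ = ENNReal.ofReal δ * (ENNReal.ofReal ρ * (ENNReal.ofReal ρ)⁻¹) * ((C + 1)⁻¹ * (C + 1)) *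
          ENNReal.ofReal (8 * R) * ballMoment (ν s) q (δ * δ') := by
        rw [ENNReal.mul_inv_cancel hρ0 ENNReal.ofReal_ne_top, ENNReal.inv_mul_cancel hC0 hCt,
          mul_one, mul_one]
    _ = _ := by ring

end IsSelfSimilarFamily

/-! ### Growth exponents of almost multiplicative functions -/

theorem tendsto_neg_log_atTop : Tendsto (fun δ : ℝ => -Real.log δ) (𝓝[>] 0) atTop :=
  tendsto_neg_atBot_atTop.comp Real.tendsto_log_nhdsGT_zero

theorem tendsto_div_of_abs_sub_le {α : Type*} {l : Filter α} {f f' g : α → ℝ} {a B : ℝ}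
    (h : Tendsto (fun x => f x / g x) l (𝓝 a)) (hg : Tendsto g l atTop)
    (hB : ∀ᶠ x in l, |f' x - f x| ≤ B) : Tendsto (fun x => f' x / g x) l (𝓝 a) := by
  have h0 : Tendsto (fun x => (f' x - f x) / g x) l (𝓝 0) := by
    refine squeeze_zero_norm' ?_ (hg.const_div_atTop B)
    filter_upwards [hB, hg.eventually_gt_atTop 0] with x hx hgx
    rw [Real.norm_eq_abs, abs_div, abs_of_pos hgx]
    gcongr
  have h1 := h.add h0
  rw [add_zero] at h1
  refine h1.congr fun x => ?_
  rw [← add_div, add_sub_cancel]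

/-- With `n = ⌊log₂ (1/δ)⌋` one has `δ ≤ 2^(-n) ≤ 2δ`, so monotonicity and doubling keep `log F`
within a bounded distance of its dyadic value. -/
theorem tendsto_log_div_of_dyadic {F : ℝ → ℝ} (hpos : ∀ δ, 0 < δ → 0 < F δ) (hmono : Monotone F) {C : ℝ}
    (hdouble : ∀ δ, 0 < δ → F (2 * δ) ≤ C * F δ) {L : ℝ}
    (hL : Tendsto (fun n : ℕ => Real.log (F ((1 / 2) ^ n)) / n) atTop (𝓝 L)) :
    Tendsto (fun δ => Real.log (F δ) / -Real.log δ) (𝓝[>] 0) (𝓝 (L * (1 / Real.log 2))) := by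
  have hl2 : 0 < Real.log 2 := Real.log_pos one_lt_two
  set n : ℝ → ℕ := fun δ => ⌊-Real.log δ / Real.log 2⌋₊ with hn
  have hquot : Tendsto (fun δ : ℝ => -Real.log δ / Real.log 2) (𝓝[>] 0) atTop :=
    tendsto_neg_log_atTop.atTop_div_const hl2
  have hnt : Tendsto n (𝓝[>] 0) atTop := tendsto_nat_floor_atTop.comp hquot
  have h1 : Tendsto (fun δ => (n δ : ℝ) / -Real.log δ) (𝓝[>] 0) (𝓝 (1 / Real.log 2)) := by
    refine ((tendsto_nat_floor_div_atTop.comp hquot).div_const (Real.log 2)).congr fun δ => ?_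
    simp only [Function.comp_apply, hn]
    field_simp
  have h2 : Tendsto (fun δ => Real.log (F ((1 / 2) ^ n δ)) / -Real.log δ) (𝓝[>] 0)
      (𝓝 (L * (1 / Real.log 2))) := by
    refine ((hL.comp hnt).mul h1).congr' ?_
    filter_upwards [hnt.eventually_gt_atTop 0] with δ hδ
    have : (n δ : ℝ) ≠ 0 := by exact_mod_cast hδ.ne'
    simp only [Function.comp_apply]
    field_simp
  refine tendsto_div_of_abs_sub_le (B := Real.log C) h2 tendsto_neg_log_atTop ?_
  filter_upwards [Ioo_mem_nhdsGT one_pos] with δ hδ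
  have hd0 : 0 < δ := hδ.1
  have hlog : Real.log δ < 0 := Real.log_neg hδ.1 hδ.2
  have hle : δ ≤ (1 / 2) ^ n δ := by
    rw [← Real.log_le_log_iff hd0 (by positivity), Real.log_pow, one_div, Real.log_inv]
    have := Nat.floor_le (div_nonneg (neg_nonneg.2 hlog.le) hl2.le)
    rw [le_div_iff₀ hl2] at this
    simp only [hn]
    linarith
  have hge : (1 / 2) ^ n δ ≤ 2 * δ := by
    rw [← Real.log_le_log_iff (by positivity) (by positivity), Real.log_pow, one_div,
      Real.log_inv, Real.log_mul two_ne_zero hd0.ne']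
    have := (Nat.lt_floor_add_one (-Real.log δ / Real.log 2)).le
    rw [div_le_iff₀ hl2] at this
    simp only [hn]
    linarith
  have hF1 : Real.log (F δ) ≤ Real.log (F ((1 / 2) ^ n δ)) :=
    Real.log_le_log (hpos δ hd0) (hmono hle)
  have hC : 0 < C := pos_of_mul_pos_left ((hpos (2 * δ) (by linarith)).trans_le (hdouble δ hd0))
    (hpos δ hd0).le
  have hF2 : Real.log (F ((1 / 2) ^ n δ)) ≤ Real.log C + Real.log (F δ) := by
    rw [← Real.log_mul hC.ne' (hpos δ hd0).ne']
    exact Real.log_le_log (hpos _ (by positivity)) ((hmono hge).trans (hdouble δ hd0))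
  rw [abs_sub_comm, abs_of_nonneg (by linarith)]
  linarith

theorem exists_tendsto_log_div_of_submultiplicative {F : ℝ → ℝ} (hpos : ∀ δ, 0 < δ → 0 < F δ)
    (hmono : Monotone F) {C : ℝ}
    (hdouble : ∀ δ, 0 < δ → F (2 * δ) ≤ C * F δ) {K : ℝ}
    (hK : ∀ δ δ', 0 < δ → δ ≤ 1 → 0 < δ' → δ' ≤ 1 → F (δ * δ') ≤ K * (F δ * F δ')) :
    ∃ a, Tendsto (fun δ => Real.log (F δ) / -Real.log δ) (𝓝[>] 0) (𝓝 a) := by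
  have hx : ∀ n : ℕ, 0 < ((1 / 2 : ℝ)) ^ n ∧ ((1 / 2 : ℝ)) ^ n ≤ 1 := fun n =>
    ⟨by positivity, pow_le_one₀ (by norm_num) (by norm_num)⟩
  have hF : ∀ n : ℕ, 0 < F ((1 / 2) ^ n) := fun n => hpos _ (hx n).1
  have hKpos : 0 < K := pos_of_mul_pos_left ((hpos (1 * 1) (by norm_num)).trans_le
    (hK 1 1 one_pos le_rfl one_pos le_rfl)) (mul_pos (hpos 1 one_pos) (hpos 1 one_pos)).le
  have hC : 0 < C := pos_of_mul_pos_left ((hpos (2 * 1) (by linarith)).trans_le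
    (hdouble 1 one_pos)) (hpos 1 one_pos).le
  set u : ℕ → ℝ := fun n => Real.log (F ((1 / 2) ^ n)) + Real.log K with hu
  have hsub : Subadditive u := fun m n => by
    have h0 := hK _ _ (hx m).1 (hx m).2 (hx n).1 (hx n).2
    rw [← pow_add] at h0
    have h1 := Real.log_le_log (hF (m + n)) h0
    rw [Real.log_mul hKpos.ne' (mul_pos (hF m) (hF n)).ne',
      Real.log_mul (hF m).ne' (hF n).ne'] at h1
    simp only [hu]
    linarith
  -- Doubling `n` times from `2^(-n)` up to `1`; this is the linear lower bound that keeps Fekete's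
  -- limit finite.
  have hlow : ∀ n : ℕ, Real.log (F 1) - n * Real.log C ≤ Real.log (F ((1 / 2) ^ n)) := fun n => by
    induction n with
    | zero => simp
    | succ n ih =>
      have h1 := Real.log_le_log (hpos _ (by positivity)) (hdouble ((1 / 2) ^ (n + 1)) (hx _).1)
      rw [Real.log_mul hC.ne' (hF _).ne', pow_succ, mul_comm ((1 / 2 : ℝ) ^ n), ← mul_assoc] at h1
      norm_num at h1 ih ⊢
      rw [pow_succ, mul_comm ((1 / 2 : ℝ) ^ n)]
      linarith
  have hbdd : BddBelow (Set.range fun n => u n / n) := by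
    refine ⟨-(|Real.log (F 1) + Real.log K| + |Real.log C|), ?_⟩
    rintro _ ⟨n, rfl⟩
    rcases Nat.eq_zero_or_pos n with rfl | hn
    · simp only [Nat.cast_zero, div_zero]
      have := abs_nonneg (Real.log (F 1) + Real.log K)
      have := abs_nonneg (Real.log C)
      linarith
    · have hn' : (1 : ℝ) ≤ n := by exact_mod_cast hn
      simp only
      rw [le_div_iff₀ (by linarith)]
      have h1 := neg_abs_le (Real.log (F 1) + Real.log K)
      have h2 := le_abs_self (Real.log C)
      have h3 := hlow n
      have h4 := abs_nonneg (Real.log (F 1) + Real.log K)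
      simp only [hu]
      nlinarith
  have hlim := hsub.tendsto_lim hbdd
  refine ⟨_, tendsto_log_div_of_dyadic hpos hmono hdouble (L := hsub.lim) ?_⟩
  exact tendsto_div_of_abs_sub_le (B := |Real.log K|) hlim tendsto_natCast_atTop_atTop
    (Eventually.of_forall fun n => by simp [hu])

theorem exists_tendsto_log_div_of_supermultiplicative {F : ℝ → ℝ} (hpos : ∀ δ, 0 < δ → 0 < F δ)
    (hmono : Monotone F) {C : ℝ}
    (hdouble : ∀ δ, 0 < δ → F (2 * δ) ≤ C * F δ) {K : ℝ}
    (hK : ∀ δ δ', 0 < δ → δ ≤ 1 → 0 < δ' → δ' ≤ 1 → F δ * F δ' ≤ K * F (δ * δ')) :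
    ∃ a, Tendsto (fun δ => Real.log (F δ) / -Real.log δ) (𝓝[>] 0) (𝓝 a) := by
  have hx : ∀ n : ℕ, 0 < ((1 / 2 : ℝ)) ^ n ∧ ((1 / 2 : ℝ)) ^ n ≤ 1 := fun n =>
    ⟨by positivity, pow_le_one₀ (by norm_num) (by norm_num)⟩
  have hF : ∀ n : ℕ, 0 < F ((1 / 2) ^ n) := fun n => hpos _ (hx n).1
  have hKpos : 0 < K := pos_of_mul_pos_left ((mul_pos (hpos 1 one_pos) (hpos 1 one_pos)).trans_le
    (hK 1 1 one_pos le_rfl one_pos le_rfl)) (hpos (1 * 1) (by norm_num)).le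
  -- Negation makes the sequence subadditive; monotonicity of `F` alone then bounds `u n / n` below.
  set u : ℕ → ℝ := fun n => -Real.log (F ((1 / 2) ^ n)) + Real.log K with hu
  have hsub : Subadditive u := fun m n => by
    have h1 := Real.log_le_log (mul_pos (hF m) (hF n))
      (hK _ _ (hx m).1 (hx m).2 (hx n).1 (hx n).2)
    rw [← pow_add, Real.log_mul hKpos.ne' (hF _).ne', Real.log_mul (hF m).ne' (hF n).ne'] at h1
    simp only [hu]
    linarith
  have hbdd : BddBelow (Set.range fun n => u n / n) := by
    refine ⟨-|-Real.log (F 1) + Real.log K|, ?_⟩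
    rintro _ ⟨n, rfl⟩
    have h4 := abs_nonneg (-Real.log (F 1) + Real.log K)
    rcases Nat.eq_zero_or_pos n with rfl | hn
    · simp
    · have hn' : (1 : ℝ) ≤ n := by exact_mod_cast hn
      simp only
      rw [le_div_iff₀ (by linarith)]
      have h1 := neg_abs_le (-Real.log (F 1) + Real.log K)
      have h2 := Real.log_le_log (hF n) (hmono (hx n).2)
      simp only [hu]
      nlinarith
  have hlim := (hsub.tendsto_lim hbdd).neg
  refine ⟨_, tendsto_log_div_of_dyadic hpos hmono hdouble (L := -hsub.lim) ?_⟩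
  refine tendsto_div_of_abs_sub_le (B := |Real.log K|) (f := fun n => -u n)
    (hlim.congr fun n => (neg_div _ _).symm) tendsto_natCast_atTop_atTop
    (Eventually.of_forall fun n => by simp [hu])

/-! ### Existence of the spectrum -/

theorem hasLqSpectrum_of_tendsto {ν : Measure ℝ} {q τ : ℝ}
    (h : Tendsto (fun δ => Real.log (meshSum ν q δ) / -Real.log δ) (𝓝[>] 0) (𝓝 τ)) :
    HasLqSpectrum ν q τ := by
  have h' : Tendsto (fun δ => ((Real.log (meshSum ν q δ) / -Real.log δ : ℝ) : EReal)) (𝓝[>] 0)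
      (𝓝 (τ : EReal)) := (continuous_coe_real_ereal.tendsto τ).comp h
  exact ⟨h'.liminf_eq, h'.limsup_eq⟩

theorem abs_log_sub_log_le {x y C C' : ℝ} (hx : 0 < x) (hy : 0 < y) (h : x ≤ C * y)
    (h' : y ≤ C' * x) : |Real.log x - Real.log y| ≤ |Real.log C| + |Real.log C'| := by
  have hC : 0 < C := pos_of_mul_pos_left (hx.trans_le h) hy.le
  have hC' : 0 < C' := pos_of_mul_pos_left (hy.trans_le h') hx.le
  have h1 := Real.log_le_log hx h
  have h2 := Real.log_le_log hy h'
  rw [Real.log_mul hC.ne' hy.ne'] at h1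
  rw [Real.log_mul hC'.ne' hx.ne'] at h2
  have := le_abs_self (Real.log C)
  have := le_abs_self (Real.log C')
  have := abs_nonneg (Real.log C)
  have := abs_nonneg (Real.log C')
  rw [abs_le]
  constructor <;> linarith

theorem toReal_le_mul_toReal {x y C : ℝ≥0∞} (hC : C ≠ ∞) (hy : y ≠ ∞) (h : x ≤ C * y) :
    x.toReal ≤ C.toReal * y.toReal := by
  rw [← ENNReal.toReal_mul]
  exact ENNReal.toReal_mono (ENNReal.mul_ne_top hC hy) h

theorem hasLqSpectrum_of_tendsto_ballMoment {ν : Measure ℝ} [IsProbabilityMeasure ν] {q : ℝ}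
    (hq : 0 ≤ q) {R : ℝ} (hR : ν (Metric.closedBall 0 R)ᶜ = 0) {a : ℝ}
    (h : Tendsto (fun δ => Real.log (ballMoment ν q δ).toReal / -Real.log δ) (𝓝[>] 0) (𝓝 a)) :
    HasLqSpectrum ν q (a + 1) := by
  apply hasLqSpectrum_of_tendsto
  -- The mesh sum is comparable to the ball moment divided by `δ`, and that division raises the
  -- exponent by `1`.
  have h1 : Tendsto (fun δ => Real.log ((ballMoment ν q δ).toReal / δ) / -Real.log δ) (𝓝[>] 0)
      (𝓝 (a + 1)) := by
    refine (h.add_const 1).congr' ?_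
    filter_upwards [Ioo_mem_nhdsGT one_pos] with δ hδ
    have hlog : Real.log δ < 0 := Real.log_neg hδ.1 hδ.2
    have hI : (ballMoment ν q δ).toReal ≠ 0 :=
      (ENNReal.toReal_pos (ballMoment_ne_zero ν hq hR hδ.1) (ballMoment_ne_top ν hq hR δ)).ne'
    rw [Real.log_div hI hδ.1.ne', sub_eq_add_neg, add_div, div_self (neg_ne_zero.2 hlog.ne)]
  set A : ℝ≥0∞ := 2 ^ q * 2 ^ q * 3 with hA
  have hAt : A ≠ ∞ := ENNReal.mul_ne_top (ENNReal.mul_ne_top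
    (ENNReal.rpow_ne_top_of_nonneg hq (by simp)) (ENNReal.rpow_ne_top_of_nonneg hq (by simp)))
    (by simp)
  refine tendsto_div_of_abs_sub_le (B := |Real.log 1| + |Real.log A.toReal|) h1
    tendsto_neg_log_atTop ?_
  filter_upwards [self_mem_nhdsWithin] with δ (hδ : 0 < δ)
  have hI0 := ballMoment_ne_zero ν hq hR hδ
  have hIt := ballMoment_ne_top ν hq hR δ
  have hI : 0 < (ballMoment ν q δ).toReal := ENNReal.toReal_pos hI0 hIt
  have h2 := mul_meshMoment_le ν hq hδ
  have h3 := ballMoment_le_mul_meshMoment ν hq hδ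
  have hDt : ENNReal.ofReal δ * meshMoment ν q δ ≠ ∞ := (h2.trans_lt hIt.lt_top).ne
  have h2' := ENNReal.toReal_mono hIt h2
  have h3' := toReal_le_mul_toReal hAt hDt h3
  have hmesh : (ENNReal.ofReal δ * meshMoment ν q δ).toReal = δ * meshSum ν q δ := by
    rw [ENNReal.toReal_mul, ENNReal.toReal_ofReal hδ.le, toReal_meshMoment ν hq]
  rw [hmesh] at h2' h3'
  have hD : 0 < meshSum ν q δ := by
    by_contra hcon
    have h5 : A.toReal * (δ * meshSum ν q δ) ≤ 0 := mul_nonpos_of_nonneg_of_nonpos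
      ENNReal.toReal_nonneg (mul_nonpos_of_nonneg_of_nonpos hδ.le (not_lt.1 hcon))
    linarith
  refine abs_log_sub_log_le hD (div_pos hI hδ) ?_ ?_
  · rw [one_mul, le_div_iff₀ hδ]
    linarith
  · rw [div_le_iff₀ hδ]
    linarith

theorem IsSelfSimilarFamily.exists_hasLqSpectrum {S E : Type*} [DecidableEq S] [Finite S]
    [Fintype E] {src tgt : E → S} {p : E → ℝ≥0∞} {c t : E → ℝ} {ν : S → Measure ℝ}
    (h : IsSelfSimilarFamily src tgt p c t ν) {q : ℝ} (hq : 0 ≤ q) (s : S)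
    (hs : ∀ u, Reach src tgt s u → Reach src tgt u s) :
    ∃ τ : ℝ, ∀ u, Reach src tgt s u → HasLqSpectrum (ν u) q τ := by
  have hprob := h.isProbability
  obtain ⟨R, hR⟩ := h.bounded
  have hIt : ∀ u δ, ballMoment (ν u) q δ ≠ ∞ := fun u δ => ballMoment_ne_top (ν u) hq (hR u) δ
  have hpos : ∀ u δ, 0 < δ → 0 < (ballMoment (ν u) q δ).toReal := fun u δ hδ =>
    ENNReal.toReal_pos (ballMoment_ne_zero (ν u) hq (hR u) hδ) (hIt u δ)
  have hmono : Monotone fun δ => (ballMoment (ν s) q δ).toReal := fun _ _ hle =>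
    ENNReal.toReal_mono (hIt s _) (ballMoment_mono (ν s) hq hle)
  have hdouble : ∀ δ, 0 < δ → (ballMoment (ν s) q (2 * δ)).toReal ≤
      (2 ^ q * 2 : ℝ≥0∞).toReal * (ballMoment (ν s) q δ).toReal := fun δ _ =>
    toReal_le_mul_toReal (ENNReal.mul_ne_top (ENNReal.rpow_ne_top_of_nonneg hq (by simp))
      (by simp)) (hIt s δ) (ballMoment_two_mul_le (ν s) hq δ)
  have hlim : ∃ a, Tendsto (fun δ => Real.log (ballMoment (ν s) q δ).toReal / -Real.log δ)
      (𝓝[>] 0) (𝓝 a) := by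
    rcases le_total 1 q with hq1 | hq1
    · obtain ⟨K, hK, hle⟩ := h.exists_ballMoment_mul_le_mul hq1 s
      refine exists_tendsto_log_div_of_submultiplicative (hpos s) hmono hdouble (K := K.toReal)
        fun δ δ' h1 h2 h3 h4 => ?_
      rw [← ENNReal.toReal_mul]
      exact toReal_le_mul_toReal hK (ENNReal.mul_ne_top (hIt s δ) (hIt s δ'))
        (hle δ δ' h1 h2 h3 h4)
    · obtain ⟨K, hK, hle⟩ := h.exists_mul_ballMoment_le hq hq1 s hs
      refine exists_tendsto_log_div_of_supermultiplicative (hpos s) hmono hdouble (K := K.toReal)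
        fun δ δ' h1 h2 h3 h4 => ?_
      rw [← ENNReal.toReal_mul]
      exact toReal_le_mul_toReal hK (hIt s _) (hle δ δ' h1 h2 h3 h4)
  obtain ⟨a, ha⟩ := hlim
  refine ⟨a + 1, fun u hu => hasLqSpectrum_of_tendsto_ballMoment hq (hR u) ?_⟩
  obtain ⟨C, hC, hle⟩ := h.exists_ballMoment_le_of_forall_reach hq
  refine tendsto_div_of_abs_sub_le (B := |Real.log C.toReal| + |Real.log C.toReal|) ha
    tendsto_neg_log_atTop ?_
  filter_upwards [self_mem_nhdsWithin] with δ (hδ : 0 < δ)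
  exact abs_log_sub_log_le (hpos u δ hδ) (hpos s δ hδ)
    (toReal_le_mul_toReal hC (hIt s δ) (hle s u hu δ hδ.le))
    (toReal_le_mul_toReal hC (hIt u δ) (hle u s (hs u hu) δ hδ.le))

/-! ### The cover of the graph by the coordinate axes -/

namespace GIFS

variable {V E : Type*}

open Classical in
/-- The coordinate of the argument on which the coordinate `i` of the value of `ψ e` depends. -/
def axis (G : GIFS V E) (e : E) (i : Fin 2) : Fin 2 :=
  if IsContractingDiagonal (G.T e) then i else i.rev

/-- The exchange of the two axes is an automorphism of the cover. -/
theorem axis_rev (G : GIFS V E) (e : E) (i : Fin 2) : G.axis e i.rev = (G.axis e i).rev := by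
  unfold axis
  split_ifs <;> rfl

theorem ψ_apply (G : GIFS V E) (e : E) (ξ : Fin 2 → ℝ) (i : Fin 2) :
    G.ψ e ξ i = G.T e i (G.axis e i) * ξ (G.axis e i) + G.t e i := by
  unfold axis ψ
  split_ifs with h
  · obtain ⟨a, b, -, -, hT⟩ := h
    rw [hT]
    fin_cases i <;> simp [dotProduct, Fin.sum_univ_two]
  · obtain ⟨a, b, -, -, hT⟩ := (G.boxLike e).resolve_left h
    rw [hT]
    fin_cases i <;> simp [dotProduct, Fin.sum_univ_two]

theorem abs_ratio (G : GIFS V E) (e : E) (i : Fin 2) :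
    0 < |G.T e i (G.axis e i)| ∧ |G.T e i (G.axis e i)| < 1 := by
  unfold axis
  split_ifs with h
  · obtain ⟨a, b, ha, hb, hT⟩ := h
    rw [hT]
    fin_cases i
    · simpa using ha
    · simpa using hb
  · obtain ⟨a, b, ha, hb, hT⟩ := (G.boxLike e).resolve_left h
    rw [hT]
    fin_cases i
    · simpa using ha
    · simpa using hb

/-- The edge `z.1` of the graph, seen as an edge between coordinate axes, starts here. -/
def coverSrc (G : GIFS V E) (z : E × Fin 2) : V × Fin 2 := (G.src z.1, z.2)

/-- The edge `z.1` of the graph, seen as an edge between coordinate axes, ends here. -/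
def coverTgt (G : GIFS V E) (z : E × Fin 2) : V × Fin 2 := (G.tgt z.1, G.axis z.1 z.2)

/-- Reachability between coordinate axes. -/
def CoverReach (G : GIFS V E) : V × Fin 2 → V × Fin 2 → Prop := Reach G.coverSrc G.coverTgt

theorem CoverReach.trans {G : GIFS V E} {a b c : V × Fin 2} (h : G.CoverReach a b)
    (h' : G.CoverReach b c) : G.CoverReach a c :=
  Relation.ReflTransGen.trans h h'

theorem CoverReach.rev {G : GIFS V E} {a b : V × Fin 2} (h : G.CoverReach a b) :
    G.CoverReach (a.1, a.2.rev) (b.1, b.2.rev) := by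
  refine Relation.ReflTransGen.lift (fun a : V × Fin 2 => (a.1, a.2.rev)) ?_ _ _ h
  rintro _ _ ⟨⟨e, i⟩, rfl, rfl⟩
  exact ⟨(e, i.rev), rfl, by simp [coverTgt, axis_rev]⟩

theorem StronglyConnected.exists_coverReach {G : GIFS V E} (hG : G.StronglyConnected) (v v' : V)
    (i : Fin 2) : ∃ i', G.CoverReach (v, i) (v', i') := by
  induction hG v v' with
  | single h =>
    obtain ⟨e, rfl, rfl⟩ := h
    exact ⟨_, .single ⟨(e, i), rfl, rfl⟩⟩
  | tail _ h ih =>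
    obtain ⟨e, rfl, rfl⟩ := h
    obtain ⟨j, hj⟩ := ih
    exact ⟨_, hj.tail ⟨(e, j), rfl, rfl⟩⟩

theorem StronglyConnected.coverReach_of_diagonal {G : GIFS V E} (hG : G.StronglyConnected)
    (hT : ∀ e, IsContractingDiagonal (G.T e)) (v v' : V) (i : Fin 2) :
    G.CoverReach (v, i) (v', i) := by
  have hax : ∀ e, G.axis e i = i := fun e => by simp [axis, hT e]
  induction hG v v' with
  | single h =>
    obtain ⟨e, rfl, rfl⟩ := h
    exact .single ⟨(e, i), rfl, by simp [coverTgt, hax]⟩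
  | tail _ h ih =>
    obtain ⟨e, rfl, rfl⟩ := h
    exact ih.tail ⟨(e, i), rfl, by simp [coverTgt, hax]⟩

theorem eq_or_eq_rev (i j : Fin 2) : j = i ∨ j = i.rev := by
  revert i j
  decide

/-- A return path in the base lifts to a path from `b` to an axis over `a.1`. If this is the wrong
axis, then `a` reaches its own flip; flipping that path leads from the flip back to `a`. -/
theorem StronglyConnected.coverReach_symm {G : GIFS V E} (hG : G.StronglyConnected)
    {a b : V × Fin 2} (h : G.CoverReach a b) : G.CoverReach b a := by
  obtain ⟨j, hj⟩ := hG.exists_coverReach b.1 a.1 b.2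
  have hba : G.CoverReach b (a.1, j) := hj
  rcases eq_or_eq_rev a.2 j with rfl | rfl
  · exact hba
  · have h' : G.CoverReach (a.1, a.2.rev) (a.1, a.2.rev.rev) := (h.trans hba).rev
    rw [Fin.rev_rev] at h'
    exact hba.trans h'

variable [DecidableEq V] [Fintype E]

theorem IsMeasureFamily.proj_eq_sum {G : GIFS V E} {p : E → ℝ} {μ : V → Measure (Fin 2 → ℝ)}
    (hμ : G.IsMeasureFamily p μ) (v : V) (i : Fin 2) :
    proj (μ v) i = ∑ e with G.src e = v, ENNReal.ofReal (p e) •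
      (proj (μ (G.tgt e)) (G.axis e i)).map fun x => G.T e i (G.axis e i) * x + G.t e i := by
  have hψ : ∀ e, Measurable (G.ψ e) := fun e => measurable_pi_lambda _ fun j => by
    simp only [ψ_apply]
    fun_prop
  unfold proj
  conv_lhs => rw [hμ.selfAffine v]
  rw [Measure.map_finset_sum (measurable_pi_apply i).aemeasurable]
  refine Finset.sum_congr rfl fun e _ => ?_
  rw [Measure.map_smul, Measure.map_map (by fun_prop) (hψ e),
    Measure.map_map (by fun_prop) (by fun_prop)]
  congr 2
  funext ξ
  exact G.ψ_apply e ξ i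

theorem IsMeasureFamily.isSelfSimilarFamily [Finite V] {G : GIFS V E} {p : E → ℝ}
    (hp : G.IsPositiveVector p) {μ : V → Measure (Fin 2 → ℝ)} (hμ : G.IsMeasureFamily p μ) :
    IsSelfSimilarFamily G.coverSrc G.coverTgt (fun z => ENNReal.ofReal (p z.1))
      (fun z => G.T z.1 z.2 (G.axis z.1 z.2)) (fun z => G.t z.1 z.2)
      (fun s => proj (μ s.1) s.2) where
  isProbability s := by
    have := hμ.isProbability s.1
    exact Measure.isProbabilityMeasure_map (measurable_pi_apply s.2).aemeasurable
  bounded := by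
    obtain ⟨X, hX, hsupp⟩ := hμ.supported
    have hb : Bornology.IsBounded (⋃ v, X v) :=
      Bornology.isBounded_iUnion.2 fun v => (hX v).2.1.isBounded
    obtain ⟨R, hR⟩ := hb.subset_closedBall 0
    refine ⟨R, fun s => ?_⟩
    unfold proj
    rw [Measure.map_apply (by fun_prop) Metric.isClosed_closedBall.measurableSet.compl]
    refine measure_mono_null (t := (X s.1)ᶜ) (fun ξ hξ hξ' => hξ ?_) (hsupp s.1)
    have h1 := hR (Set.mem_iUnion.2 ⟨s.1, hξ'⟩)
    rw [mem_closedBall_zero_iff] at h1 ⊢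
    exact (norm_le_pi_norm ξ s.2).trans h1
  weight_ne_zero z := by simpa using hp.1 z.1
  weight_ne_top z := ENNReal.ofReal_ne_top
  ratio_ne_zero z := abs_pos.1 (G.abs_ratio z.1 z.2).1
  ratio_lt_one z := (G.abs_ratio z.1 z.2).2
  selfSimilar s := by
    rw [hμ.proj_eq_sum s.1 s.2]
    refine Finset.sum_nbij' (fun e => (e, s.2)) (fun z => z.1) ?_ ?_ ?_ ?_ ?_
    · intro e he
      simp only [Finset.mem_filter, Finset.mem_univ, true_and] at he ⊢
      exact Prod.ext he rfl
    · intro z hz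
      simp only [Finset.mem_filter, Finset.mem_univ, true_and] at hz ⊢
      rw [← hz, coverSrc]
    · intro e _
      rfl
    · intro z hz
      simp only [Finset.mem_filter, Finset.mem_univ, true_and] at hz
      rw [← hz, coverSrc]
    · intro e _
      rfl

theorem IsMeasureFamily.exists_spectrum [Finite V] {G : GIFS V E} (hG : G.StronglyConnected)
    {p : E → ℝ} (hp : G.IsPositiveVector p) {μ : V → Measure (Fin 2 → ℝ)}
    (hμ : G.IsMeasureFamily p μ) {q : ℝ} (hq : 0 ≤ q) (s : V × Fin 2) :
    ∃ τ : ℝ, ∀ u, G.CoverReach s u → HasLqSpectrum (proj (μ u.1) u.2) q τ :=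
  (hμ.isSelfSimilarFamily hp).exists_hasLqSpectrum hq s fun _ h => hG.coverReach_symm h

end GIFS

/-! ### Splittings -/

theorem ncard_eq_card_of_fst_bijective {V : Type*} {A : Set (V × Fin 2)}
    (hA : ∀ v, ∃! i, (v, i) ∈ A) : A.ncard = Nat.card V := by
  refine Nat.card_congr (Equiv.ofBijective (fun a : A => a.1.1) ⟨?_, ?_⟩)
  · rintro ⟨⟨v, i⟩, hi⟩ ⟨⟨w, j⟩, hj⟩ (rfl : v = w)
    rw [Subtype.mk.injEq, (hA v).unique hi hj]
  · intro v
    obtain ⟨i, hi, -⟩ := hA v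
    exact ⟨⟨(v, i), hi⟩, rfl⟩

/-- Disjointness and the separation of the two axes at each vertex force each family to contain
exactly one axis per vertex, which settles covering and cardinality. -/
theorem isSpectralSplitting_of_separates {V : Type*} {μ : V → Measure (Fin 2 → ℝ)}
    {A B : Set (V × Fin 2)} (hd : Disjoint A B)
    (hs : ∀ v, ((v, 0) ∈ A ∧ (v, 1) ∈ B) ∨ ((v, 0) ∈ B ∧ (v, 1) ∈ A))
    (hA : ∀ q : ℝ, 0 ≤ q → ∃ τ : ℝ, ∀ m ∈ A, HasLqSpectrum (proj (μ m.1) m.2) q τ)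
    (hB : ∀ q : ℝ, 0 ≤ q → ∃ τ : ℝ, ∀ m ∈ B, HasLqSpectrum (proj (μ m.1) m.2) q τ) :
    IsSpectralSplitting μ A B := by
  have hd' : ∀ {m}, m ∈ A → m ∉ B := fun h h' => Set.disjoint_left.1 hd h h'
  refine ⟨?_, hd, ncard_eq_card_of_fst_bijective fun v => ?_,
    ncard_eq_card_of_fst_bijective fun v => ?_, fun q hq => ?_, hs⟩
  · refine Set.eq_univ_of_forall fun ⟨v, i⟩ => ?_
    fin_cases i <;> rcases hs v with h | h
    exacts [.inl h.1, .inr h.1, .inr h.2, .inl h.2]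
  · rcases hs v with h | h
    · refine ⟨0, h.1, fun j hj => ?_⟩
      fin_cases j
      exacts [rfl, absurd h.2 (hd' hj)]
    · refine ⟨1, h.2, fun j hj => ?_⟩
      fin_cases j
      exacts [absurd h.1 (hd' hj), rfl]
  · rcases hs v with h | h
    · refine ⟨1, h.2, fun j hj => ?_⟩
      fin_cases j
      exacts [absurd hj (hd' h.1), rfl]
    · refine ⟨0, h.1, fun j hj => ?_⟩
      fin_cases j
      exacts [rfl, absurd hj (hd' h.2)]
  · obtain ⟨τA, hτA⟩ := hA q hq
    obtain ⟨τB, hτB⟩ := hB q hq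
    exact ⟨τA, τB, hτA, hτB⟩

theorem isSpectralSplitting_axes {V : Type*} {μ : V → Measure (Fin 2 → ℝ)}
    (h : ∀ (i : Fin 2) (q : ℝ), 0 ≤ q → ∃ τ : ℝ, ∀ v, HasLqSpectrum (proj (μ v) i) q τ) :
    IsSpectralSplitting μ {m | m.2 = 0} {m | m.2 = 1} := by
  have hax : ∀ (i : Fin 2) (q : ℝ), 0 ≤ q →
      ∃ τ : ℝ, ∀ m ∈ {m : V × Fin 2 | m.2 = i}, HasLqSpectrum (proj (μ m.1) m.2) q τ := by
    intro i q hq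
    obtain ⟨τ, hτ⟩ := h i q hq
    refine ⟨τ, ?_⟩
    rintro ⟨v, j⟩ rfl
    exact hτ v
  refine isSpectralSplitting_of_separates ?_ (fun v => .inl ⟨rfl, rfl⟩) (hax 0) (hax 1)
  rw [Set.disjoint_left]
  intro m (h0 : m.2 = 0) (h1 : m.2 = 1)
  exact absurd (h0.symm.trans h1) (by decide)

theorem GIFS.IsMeasureFamily.exists_isSpectralSplitting {V E : Type*} [Finite V] [DecidableEq V]
    [Fintype E] {G : GIFS V E} (hG : G.StronglyConnected) {p : E → ℝ} (hp : G.IsPositiveVector p)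
    {μ : V → Measure (Fin 2 → ℝ)} (hμ : G.IsMeasureFamily p μ) :
    ∃ A B : Set (V × Fin 2), IsSpectralSplitting μ A B := by
  -- If one vertex joins its two axes, the cover is connected and any separating splitting will do.
  -- The empty graph is put here because the other case needs a base vertex.
  by_cases hswap : IsEmpty V ∨ ∃ v, G.CoverReach (v, 0) (v, 1)
  · refine ⟨_, _, isSpectralSplitting_axes fun i q hq => ?_⟩
    rcases hswap with hV | ⟨v, hv⟩
    · exact ⟨0, hV.elim⟩
    · obtain ⟨τ, hτ⟩ := hμ.exists_spectrum hG hp hq (v, 0)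
      refine ⟨τ, fun w => hτ (w, i) ?_⟩
      obtain ⟨j, hj⟩ := hG.exists_coverReach w v i
      refine CoverReach.trans ?_ (hG.coverReach_symm hj)
      fin_cases j
      exacts [.refl, hv]
  · push Not at hswap
    obtain ⟨⟨v₀⟩, hno⟩ := hswap
    have hcov : ∀ m, G.CoverReach (v₀, 0) m ∨ G.CoverReach (v₀, 1) m := fun m => by
      obtain ⟨j, hj⟩ := hG.exists_coverReach m.1 v₀ m.2
      have hj' := hG.coverReach_symm hj
      fin_cases j
      exacts [.inl hj', .inr hj']
    have hdis : ∀ m, G.CoverReach (v₀, 0) m → ¬ G.CoverReach (v₀, 1) m := fun m h0 h1 =>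
      hno v₀ (h0.trans (hG.coverReach_symm h1))
    -- No component contains both axes over a vertex: by symmetry one would reach the other.
    have hsep : ∀ v s, G.CoverReach s (v, 0) → ¬ G.CoverReach s (v, 1) := fun v s h0 h1 =>
      hno v ((hG.coverReach_symm h0).trans h1)
    refine ⟨{m | G.CoverReach (v₀, 0) m}, {m | G.CoverReach (v₀, 1) m},
      isSpectralSplitting_of_separates (Set.disjoint_left.2 hdis) (fun v => ?_)
      (fun q hq => hμ.exists_spectrum hG hp hq _) (fun q hq => hμ.exists_spectrum hG hp hq _)⟩
    rcases hcov (v, 0) with h | h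
    · exact .inl ⟨h, (hcov (v, 1)).resolve_left (hsep v _ h)⟩
    · exact .inr ⟨h, (hcov (v, 1)).resolve_right (hsep v _ h)⟩

end BoxLike

end

theorem proposition2p1 {V E : Type*} [Fintype V] [DecidableEq V] [Fintype E]
    (G : BoxLike.GIFS V E) (hG : G.StronglyConnected)
    (p : E → ℝ) (hp : G.IsPositiveVector p)
    (μ : V → MeasureTheory.Measure (Fin 2 → ℝ)) (hμ : G.IsMeasureFamily p μ) :
    (∀ q : ℝ, 0 ≤ q → ∀ v : V,
      (∃ τ : ℝ, BoxLike.HasLqSpectrum (BoxLike.proj (μ v) 0) q τ) ∧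
      (∃ τ : ℝ, BoxLike.HasLqSpectrum (BoxLike.proj (μ v) 1) q τ)) ∧
    (∃ A B : Set (V × Fin 2), BoxLike.IsSpectralSplitting μ A B) ∧
    ((∀ e, BoxLike.IsContractingDiagonal (G.T e)) →
      BoxLike.IsSpectralSplitting μ {m | m.2 = 0} {m | m.2 = 1}) := by
  have hspec : ∀ q : ℝ, 0 ≤ q → ∀ s : V × Fin 2,
      ∃ τ : ℝ, BoxLike.HasLqSpectrum (BoxLike.proj (μ s.1) s.2) q τ := fun q hq s =>
    (hμ.exists_spectrum hG hp hq s).imp fun _ h => h s .refl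
  refine ⟨fun q hq v => ⟨hspec q hq (v, 0), hspec q hq (v, 1)⟩,
    hμ.exists_isSpectralSplitting hG hp, fun hT => BoxLike.isSpectralSplitting_axes ?_⟩
  intro i q hq
  cases isEmpty_or_nonempty V with
  | inl hV => exact ⟨0, hV.elim⟩
  | inr hV =>
    obtain ⟨v₀⟩ := hV
    exact (hμ.exists_spectrum hG hp hq (v₀, i)).imp fun _ h v =>
      h (v, i) (hG.coverReach_of_diagonal hT v₀ v i)
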